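/- A \emph{nice Lie algebra} is a pair $(\mathfrak g,\mathcal B)$ of a real Lie algebra $\mathfrak g$ and a basis $\mathcal B=\{e_1,\dots,e_n\}$, with dual basis $e^1,\dots,e^n$, such that each $[e_i,e_j]$ is a multiple of some $e_k$ and each interior product $e_i\lrcorner de^j$ is a multiple of some $e^k$, where $de^j(x,y)=-e^j([x,y])$. It is \emph{irreducible} if $\mathcal B$ is not a disjoint union of two nonempty subsets each spanning an ideal. Two nice Lie algebras are \emph{equivalent} if there is a Lie algebra isomorphism mapping each element of the first basis to a nonzero multiple of an element of the second. The \emph{diagonal Nikolayevsky derivation} $N$ of a nice nilpotent Lie algebra is its derivation that is diagonal with respect to $\mathcal B$ and satisfies $\operatorname{Tr}(NX)=\operatorname{Tr}X$ for all derivations $X$ of $\mathfrak g$. Let $\mathbf S$ be the set of signatures of the diagonal metrics $g=g_1e^1\otimes e^1+\dots+g_ne^n\otimes e^n$ (all $g_i\in\mathbb R\setminus\{0\}$) whose Ricci operator satisfies $$\operatorname{Ric}=-\tfrac12\operatorname{id}+\tfrac12N,\qquad N\neq0,$$ where the signature of $g$ is the set of indices $i$ with $g_i<0$, written as a string of digits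 (e.g. $13$ for $\{1,3\}$). \textbf{Theorem.} Every irreducible nice nilpotent Lie algebra of dimension $n$ with $2\le n\le 6$ is equivalent to one in the following table. Conversely, each row of the table defines an irreducible nice nilpotent Lie algebra, and for every nice Lie algebra equivalent to it, $N$ and $\mathbf S$ are those given in the row, up to the relabelling of the basis given by the equivalence. The second column lists $(de^1,\dots,de^n)$, with $e^{ij}=e^i\wedge e^j$; the third lists the diagonal entries of $N$. \begin{tabular}{llll} Name & $\mathfrak g$ & $N$ & $\mathbf S$ \\ \texttt{31:1} & $0,0,e^{12}$ & $\tfrac{2}{3}(1,1,2)$ & $\{\emptyset,12,13,23\}$ \\ \texttt{421:1} & $0,0,e^{12},e^{13}$ & $\tfrac{1}{3}(1,2,3,4)$ & $\{\emptyset,124,13,234\}$ \\ \texttt{5321:1} & $0,0,e^{12},e^{13},e^{14}$ & $\tfrac{1}{12}(2,9,11,13,15)$ & $\{\emptyset,124,135,2345\}$ \\ \texttt{5321:2} & $0,0,e^{12},e^{13},e^{14}+e^{23}$ & $\tfrac{3}{11}(1,2,3,4,5)$ & $\{\emptyset,135\}$ \\ \texttt{532:1} & $0,0,e^{12},e^{13},e^{23}$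 & $\tfrac{5}{12}(1,1,2,3,3)$ & $\{\emptyset,1245,135,234\}$ \\ \texttt{521:2} & $0,0,0,e^{12},e^{24}+e^{13}$ & $\tfrac{1}{7}(4,3,6,7,10)$ & $\{\emptyset,125,145,24\}$ \\ \texttt{52:1} & $0,0,0,e^{12},e^{13}$ & $\tfrac{1}{4}(2,3,3,5,5)$ & $\{\emptyset,123,125,134,145,2345,24,35\}$ \\ \texttt{51:2} & $0,0,0,0,e^{12}+e^{34}$ & $\tfrac{3}{4}(1,1,1,1,2)$ & $\{\emptyset,12,1234,135,145,235,245,34\}$ \\ \texttt{64321:1} & $0,0,e^{12},e^{13},e^{14},e^{15}$ & $\tfrac{1}{11}(1,9,10,11,12,13)$ & $\{\emptyset,1246,135,23456\}$ \\ \texttt{64321:2} & $0,0,e^{12},e^{13},e^{14},e^{15}+e^{23}$ & $\tfrac{13}{68}(1,3,4,5,6,7)$ & $\{\emptyset,1246\}$ \\ \texttt{64321:3} & $0,0,-e^{12},e^{13},e^{14},e^{34}+e^{25}$ & $\tfrac{1}{6}(1,3,4,5,6,9)$ & $\{\emptyset,1246,1356,2345\}$ \\ \texttt{64321:4} & $0,0,e^{12},e^{13},e^{23}+e^{14},e^{24}+e^{15}$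 & $\tfrac{3}{13}(1,2,3,4,5,6)$ & $\{\emptyset,135\}$ \\ \texttt{64321:5} & $0,0,-e^{12},e^{13},e^{23}+e^{14},e^{34}+e^{25}$ & $\tfrac{11}{52}(1,2,3,4,5,7)$ & $\{\emptyset,1356\}$ \\ \texttt{6431:1} & $0,0,e^{12},e^{13},e^{23},e^{14}$ & $\tfrac{1}{4}(1,2,3,4,5,5)$ & $\{\emptyset,1245,1356,2346\}$ \\ \texttt{6431:2a} & $0,0,e^{12},e^{13},e^{23},e^{14}+e^{25}$ & $\tfrac{7}{20}(1,1,2,3,3,4)$ & $\{\emptyset,1245,1356,2346\}$ \\ \texttt{6431:2b} & $0,0,e^{12},-e^{13},e^{23},e^{14}+e^{25}$ & $\tfrac{7}{20}(1,1,2,3,3,4)$ & $\{\emptyset,1245,1356,2346\}$ \\ \texttt{6431:3} & $0,0,e^{12},e^{13},e^{23},e^{24}+e^{15}$ & $\tfrac{7}{20}(1,1,2,3,3,4)$ & $\{\emptyset,1245,135,234\}$ \\ \texttt{6321:2} & $0,0,0,e^{12},e^{14},e^{15}+e^{23}$ & $\tfrac{1}{15}(4,9,12,13,17,21)$ & $\{\emptyset,1235,1346,2456\}$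 \\ \texttt{6321:4} & $0,0,0,-e^{12},e^{14}+e^{23},e^{15}+e^{34}$ & $\tfrac{1}{20}(6,11,12,17,23,29)$ & $\{\emptyset,125,146,2456\}$ \\ \texttt{632:2} & $0,0,0,e^{12},e^{14},e^{24}+e^{13}$ & $\tfrac{1}{13}(5,6,12,11,16,17)$ & $\{\emptyset,1256,146,245\}$ \\ \texttt{632:3a} & $0,0,0,e^{12},e^{23}+e^{14},e^{13}+e^{24}$ & $\tfrac{3}{7}(1,1,2,2,3,3)$ & $\{\emptyset,1256,146,245\}$ \\ \texttt{632:3b} & $0,0,0,e^{12},e^{23}-e^{14},e^{24}+e^{13}$ & $\tfrac{3}{7}(1,1,2,2,3,3)$ & $\{\emptyset,1256,146,245\}$ \\ \texttt{631:1} & $0,0,0,e^{12},e^{13},e^{14}$ & $\tfrac{1}{7}(2,5,6,7,8,9)$ & $\{\emptyset,1236,1256,134,145,23456,246,35\}$ \\ \texttt{631:2} & $0,0,0,e^{12},e^{13},e^{24}$ & $\tfrac{1}{12}(6,5,9,11,15,16)$ & $\{\emptyset,1236,1256,1346,1456,2345,24,35\}$ \\ \texttt{631:3} & $0,0,0,e^{12},e^{13},e^{23}+e^{14}$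 & $\tfrac{1}{8}(3,5,6,8,9,11)$ & $\{\emptyset,1256,145,246\}$ \\ \texttt{631:4} & $0,0,0,e^{12},e^{13},e^{24}+e^{15}$ & $\tfrac{2}{11}(2,3,4,5,6,8)$ & $\{\emptyset,1236,1346,24\}$ \\ \texttt{631:5a} & $0,0,0,e^{12},e^{13},e^{35}+e^{24}$ & $\tfrac{1}{2}(1,1,1,2,2,3)$ & $\{\emptyset,1236,1256,1346,1456,2345,24,35\}$ \\ \texttt{631:5b} & $0,0,0,-e^{12},e^{13},e^{24}+e^{35}$ & $\tfrac{1}{2}(1,1,1,2,2,3)$ & $\{\emptyset,1236,1256,1346,1456,2345,24,35\}$ \\ \texttt{631:6} & $0,0,0,e^{12},e^{13},e^{34}+e^{25}$ & $\tfrac{1}{2}(1,1,1,2,2,3)$ & $\{\emptyset,1236,125,134,1456,2345,246,356\}$ \\ \texttt{63:1} & $0,0,0,e^{12},e^{13},e^{23}$ & $\tfrac{3}{5}(1,1,1,2,2,2)$ & $\{\emptyset,123,1256,1346,145,2345,246,356\}$ \\ \texttt{621:3} & $0,0,0,0,e^{12},e^{15}+e^{34}$ & $\tfrac{1}{12}(5,8,9,9,13,18)$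 & $\{\emptyset,1236,1246,1345,15,2356,2456,34\}$ \\ \texttt{62:3} & $0,0,0,0,e^{12},e^{13}+e^{24}$ & $\tfrac{1}{5}(3,3,4,4,6,7)$ & $\{\emptyset,1234,126,135,1456,2356,245,346\}$ \\ \texttt{62:4a} & $0,0,0,0,e^{13}+e^{24},e^{34}+e^{12}$ & $\tfrac{2}{3}(1,1,1,1,2,2)$ & $\{\emptyset,1234,125,136,1456,2356,246,345\}$ \\ \texttt{62:4b} & $0,0,0,0,e^{24}-e^{13},e^{34}+e^{12}$ & $\tfrac{2}{3}(1,1,1,1,2,2)$ & $\{\emptyset,1234,125,136,1456,2356,246,345\}$ \\ \end{tabular} -/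

import Mathlib

open Module

namespace NiceNilsoliton

/-! ### Ricci operator of a left-invariant pseudo-Riemannian metric -/

section Geometry

variable {L : Type*} [LieRing L] [LieAlgebra ℝ L]

/-- `D` is the Levi-Civita connection, restricted to left-invariant vector fields, of the
left-invariant metric `B`: it is torsion-free and compatible with the metric. -/
structure IsLeviCivita (B : LinearMap.BilinForm ℝ L) (D : L →ₗ[ℝ] L →ₗ[ℝ] L) : Prop where
  torsionFree : ∀ x y, D x y - D y x = ⁅x, y⁆
  metric : ∀ x y z, B (D x y) z + B y (D x z) = 0

/-- The endomorphism `x ↦ R(x, y) z`, with `R(x, y) = D_x D_y - D_y D_x - D_[x, y]`. -/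
def curvature (D : L →ₗ[ℝ] L →ₗ[ℝ] L) (y z : L) : L →ₗ[ℝ] L where
  toFun x := D x (D y z) - D y (D x z) - D ⁅x, y⁆ z
  map_add' x x' := by
    simp only [map_add, LinearMap.add_apply, add_lie]
    abel
  map_smul' a x := by
    simp only [map_smul, LinearMap.smul_apply, smul_lie, RingHom.id_apply, smul_sub]

/-- The Ricci tensor `ric(y, z) = tr (x ↦ R(x, y) z)`. -/
noncomputable def ricciTensor (D : L →ₗ[ℝ] L →ₗ[ℝ] L) (y z : L) : ℝ :=
  LinearMap.trace ℝ L (curvature D y z)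

/-- `R` is the Ricci operator of the metric `B`: `B (R y) z = ric(y, z)`. -/
def IsRicciOperator (B : LinearMap.BilinForm ℝ L) (R : Module.End ℝ L) : Prop :=
  ∃ D : L →ₗ[ℝ] L →ₗ[ℝ] L, IsLeviCivita B D ∧ ∀ y z, B (R y) z = ricciTensor D y z

end Geometry

/-! ### Nice Lie algebras -/

section Nice

variable {L : Type*} [LieRing L] [LieAlgebra ℝ L] {n : ℕ}

/-- The interior product `e_i ⌟ de^j`, where `de^j (x, y) = - e^j [x, y]`. -/
noncomputable def interiorDiff (b : Basis (Fin n) ℝ L) (i j : Fin n) : L →ₗ[ℝ] ℝ :=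
  -((b.coord j) ∘ₗ (LieAlgebra.ad ℝ L (b i) : L →ₗ[ℝ] L))

/-- A nice basis: each bracket `[e_i, e_j]` is a multiple of some `e_k`, and each interior
product `e_i ⌟ de^j` is a multiple of some `e^k`. -/
structure IsNice (b : Basis (Fin n) ℝ L) : Prop where
  bracket : ∀ i j, ∃ (k : Fin n) (c : ℝ), ⁅b i, b j⁆ = c • b k
  interior : ∀ i j, ∃ (k : Fin n) (c : ℝ), interiorDiff b i j = c • b.coord k

/-- The basis elements with index in `s` span an ideal. -/
def SpansIdeal (b : Basis (Fin n) ℝ L) (s : Set (Fin n)) : Prop :=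
  ∃ I : LieIdeal ℝ L, I.toSubmodule = Submodule.span ℝ (b '' s)

/-- The basis is not a disjoint union of two nonempty subsets, each of which spans an ideal. -/
def IsIrreducible (b : Basis (Fin n) ℝ L) : Prop :=
  ¬ ∃ s : Set (Fin n), s.Nonempty ∧ sᶜ.Nonempty ∧ SpansIdeal b s ∧ SpansIdeal b sᶜ

/-- The diagonal endomorphism `v^D`. -/
noncomputable def diagOp (b : Basis (Fin n) ℝ L) (v : Fin n → ℝ) : Module.End ℝ L :=
  b.constr ℝ fun i => v i • b i

/-- The diagonal metric `∑ g_i e^i ⊗ e^i`. -/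
noncomputable def diagMetric (b : Basis (Fin n) ℝ L) (g : Fin n → ℝ) :
    LinearMap.BilinForm ℝ L :=
  ∑ i, g i • LinearMap.BilinForm.linMulLin (b.coord i) (b.coord i)

/-- A Nikolayevsky (pre-Einstein) derivation: semisimple, with `tr (N X) = tr X` for all
derivations `X`. -/
def IsNikolayevsky (N : LieDerivation ℝ L L) : Prop :=
  Module.End.IsSemisimple (N : L →ₗ[ℝ] L) ∧
    ∀ X : LieDerivation ℝ L L,
      LinearMap.trace ℝ L ((N : L →ₗ[ℝ] L) ∘ₗ (X : L →ₗ[ℝ] L)) =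
        LinearMap.trace ℝ L (X : L →ₗ[ℝ] L)

/-- `v^D` is the diagonal Nikolayevsky derivation of the nice Lie algebra. -/
def IsDiagonalNikolayevsky (b : Basis (Fin n) ℝ L) (v : Fin n → ℝ) : Prop :=
  ∃ N : LieDerivation ℝ L L, (N : L →ₗ[ℝ] L) = diagOp b v ∧ IsNikolayevsky N

/-- The diagonal metric `g` satisfies `Ric = -½ id + ½ N` with `N ≠ 0` the diagonal
Nikolayevsky derivation. -/
def IsNormalizedNilsoliton (b : Basis (Fin n) ℝ L) (g : Fin n → ℝ) : Prop :=
  ∃ v : Fin n → ℝ, IsDiagonalNikolayevsky b v ∧ v ≠ 0 ∧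
    IsRicciOperator (diagMetric b g)
      (-(1 / 2 : ℝ) • (1 : Module.End ℝ L) + (1 / 2 : ℝ) • diagOp b v)

/-- The set of signatures of the diagonal metrics with `Ric = -½ id + ½ N`, `N ≠ 0`; the signature
of `g` is recorded as the set of indices with `g_i < 0`. -/
def signatures (b : Basis (Fin n) ℝ L) : Set (Finset (Fin n)) :=
  {s | ∃ g : Fin n → ℝ, (∀ i, g i ≠ 0) ∧ (∀ i, i ∈ s ↔ g i < 0) ∧ IsNormalizedNilsoliton b g}

end Nice

/-! ### The table -/

/-- A row of the table. Indices are written `1, …, n` as usual.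
`d`: the components of `(de^1, …, de^n)`, each the list of its terms; `(a, i, j)` stands for
`a e^i ∧ e^j`.
`scale`, `weights`: `N` is `scale * weights` on the diagonal.
`sig`: the signatures, each given by the list of the indices `i` with `g_i < 0`. -/
structure Row where
  d : List (List (ℤ × ℕ × ℕ))
  scale : ℚ
  weights : List ℤ
  sig : List (List ℕ)

namespace Row

/-- The dimension. -/
def n (r : Row) : ℕ := r.d.length

/-- The structure constant `c_{ij}^k = - de^k (e_i, e_j)`. -/
def structConst (r : Row) (i j k : Fin r.n) : ℤ :=
  -((r.d.get k).map fun t =>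
    t.1 * ((if t.2.1 = (i : ℕ) + 1 ∧ t.2.2 = (j : ℕ) + 1 then 1 else 0) -
      (if t.2.1 = (j : ℕ) + 1 ∧ t.2.2 = (i : ℕ) + 1 then 1 else 0))).sum

/-- The diagonal of `N`. -/
def nik (r : Row) (i : Fin r.n) : ℝ := ((r.scale * r.weights.getD i 0 : ℚ) : ℝ)

/-- The set `S` of signatures. -/
def sigSet (r : Row) : Set (Finset (Fin r.n)) :=
  {s | ∃ l ∈ r.sig, ∀ i : Fin r.n, i ∈ s ↔ (i : ℕ) + 1 ∈ l}

end Row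

/-- The basis `b` satisfies the structure equations of the row `r`. -/
def HasStructure {L : Type*} [LieRing L] [LieAlgebra ℝ L] (r : Row)
    (b : Basis (Fin r.n) ℝ L) : Prop :=
  ∀ i j, ⁅b i, b j⁆ = ∑ k, (r.structConst i j k : ℝ) • b k

/-- The nice Lie algebra `(L, b)` is that of row `r`, up to the relabelling `e` and a nonzero
rescaling of the basis elements. -/
def IsEquivalentTo {L : Type*} [LieRing L] [LieAlgebra ℝ L] {n : ℕ} (b : Basis (Fin n) ℝ L)
    (r : Row) (e : Fin r.n ≃ Fin n) : Prop :=
  ∃ c : Fin r.n → ℝˣ, HasStructure r ((b.reindex e.symm).unitsSMul c)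

/-- The form `e^{ij}`. -/
abbrev e (i j : ℕ) : ℤ × ℕ × ℕ := (1, i, j)

/-- The form `- e^{ij}`. -/
abbrev neg (i j : ℕ) : ℤ × ℕ × ℕ := (-1, i, j)

/-- The irreducible nice nilpotent Lie algebras of dimension `2, …, 6`, with the diagonal
Nikolayevsky derivation and the set of signatures. -/
def table : List Row :=
  [
   -- 31:1
   ⟨[[], [], [e 1 2]],
    2/3, [1, 1, 2],
    [[], [1, 2], [1, 3], [2, 3]]⟩,
   -- 421:1
   ⟨[[], [], [e 1 2], [e 1 3]],
    1/3, [1, 2, 3, 4],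
    [[], [1, 2, 4], [1, 3], [2, 3, 4]]⟩,
   -- 5321:1
   ⟨[[], [], [e 1 2], [e 1 3], [e 1 4]],
    1/12, [2, 9, 11, 13, 15],
    [[], [1, 2, 4], [1, 3, 5], [2, 3, 4, 5]]⟩,
   -- 5321:2
   ⟨[[], [], [e 1 2], [e 1 3], [e 1 4, e 2 3]],
    3/11, [1, 2, 3, 4, 5],
    [[], [1, 3, 5]]⟩,
   -- 532:1
   ⟨[[], [], [e 1 2], [e 1 3], [e 2 3]],
    5/12, [1, 1, 2, 3, 3],
    [[], [1, 2, 4, 5], [1, 3, 5], [2, 3, 4]]⟩,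
   -- 521:2
   ⟨[[], [], [], [e 1 2], [e 2 4, e 1 3]],
    1/7, [4, 3, 6, 7, 10],
    [[], [1, 2, 5], [1, 4, 5], [2, 4]]⟩,
   -- 52:1
   ⟨[[], [], [], [e 1 2], [e 1 3]],
    1/4, [2, 3, 3, 5, 5],
    [[], [1, 2, 3], [1, 2, 5], [1, 3, 4], [1, 4, 5], [2, 3, 4, 5], [2, 4], [3, 5]]⟩,
   -- 51:2
   ⟨[[], [], [], [], [e 1 2, e 3 4]],
    3/4, [1, 1, 1, 1, 2],
    [[], [1, 2], [1, 2, 3, 4], [1, 3, 5], [1, 4, 5], [2, 3, 5], [2, 4, 5], [3, 4]]⟩,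
   -- 64321:1
   ⟨[[], [], [e 1 2], [e 1 3], [e 1 4], [e 1 5]],
    1/11, [1, 9, 10, 11, 12, 13],
    [[], [1, 2, 4, 6], [1, 3, 5], [2, 3, 4, 5, 6]]⟩,
   -- 64321:2
   ⟨[[], [], [e 1 2], [e 1 3], [e 1 4], [e 1 5, e 2 3]],
    13/68, [1, 3, 4, 5, 6, 7],
    [[], [1, 2, 4, 6]]⟩,
   -- 64321:3
   ⟨[[], [], [neg 1 2], [e 1 3], [e 1 4], [e 3 4, e 2 5]],
    1/6, [1, 3, 4, 5, 6, 9],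
    [[], [1, 2, 4, 6], [1, 3, 5, 6], [2, 3, 4, 5]]⟩,
   -- 64321:4
   ⟨[[], [], [e 1 2], [e 1 3], [e 2 3, e 1 4], [e 2 4, e 1 5]],
    3/13, [1, 2, 3, 4, 5, 6],
    [[], [1, 3, 5]]⟩,
   -- 64321:5
   ⟨[[], [], [neg 1 2], [e 1 3], [e 2 3, e 1 4], [e 3 4, e 2 5]],
    11/52, [1, 2, 3, 4, 5, 7],
    [[], [1, 3, 5, 6]]⟩,
   -- 6431:1
   ⟨[[], [], [e 1 2], [e 1 3], [e 2 3], [e 1 4]],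
    1/4, [1, 2, 3, 4, 5, 5],
    [[], [1, 2, 4, 5], [1, 3, 5, 6], [2, 3, 4, 6]]⟩,
   -- 6431:2a
   ⟨[[], [], [e 1 2], [e 1 3], [e 2 3], [e 1 4, e 2 5]],
    7/20, [1, 1, 2, 3, 3, 4],
    [[], [1, 2, 4, 5], [1, 3, 5, 6], [2, 3, 4, 6]]⟩,
   -- 6431:2b
   ⟨[[], [], [e 1 2], [neg 1 3], [e 2 3], [e 1 4, e 2 5]],
    7/20, [1, 1, 2, 3, 3, 4],
    [[], [1, 2, 4, 5], [1, 3, 5, 6], [2, 3, 4, 6]]⟩,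
   -- 6431:3
   ⟨[[], [], [e 1 2], [e 1 3], [e 2 3], [e 2 4, e 1 5]],
    7/20, [1, 1, 2, 3, 3, 4],
    [[], [1, 2, 4, 5], [1, 3, 5], [2, 3, 4]]⟩,
   -- 6321:2
   ⟨[[], [], [], [e 1 2], [e 1 4], [e 1 5, e 2 3]],
    1/15, [4, 9, 12, 13, 17, 21],
    [[], [1, 2, 3, 5], [1, 3, 4, 6], [2, 4, 5, 6]]⟩,
   -- 6321:4
   ⟨[[], [], [], [neg 1 2], [e 1 4, e 2 3], [e 1 5, e 3 4]],
    1/20, [6, 11, 12, 17, 23, 29],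
    [[], [1, 2, 5], [1, 4, 6], [2, 4, 5, 6]]⟩,
   -- 632:2
   ⟨[[], [], [], [e 1 2], [e 1 4], [e 2 4, e 1 3]],
    1/13, [5, 6, 12, 11, 16, 17],
    [[], [1, 2, 5, 6], [1, 4, 6], [2, 4, 5]]⟩,
   -- 632:3a
   ⟨[[], [], [], [e 1 2], [e 2 3, e 1 4], [e 1 3, e 2 4]],
    3/7, [1, 1, 2, 2, 3, 3],
    [[], [1, 2, 5, 6], [1, 4, 6], [2, 4, 5]]⟩,
   -- 632:3b
   ⟨[[], [], [], [e 1 2], [e 2 3, neg 1 4], [e 2 4, e 1 3]],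
    3/7, [1, 1, 2, 2, 3, 3],
    [[], [1, 2, 5, 6], [1, 4, 6], [2, 4, 5]]⟩,
   -- 631:1
   ⟨[[], [], [], [e 1 2], [e 1 3], [e 1 4]],
    1/7, [2, 5, 6, 7, 8, 9],
    [[], [1, 2, 3, 6], [1, 2, 5, 6], [1, 3, 4], [1, 4, 5], [2, 3, 4, 5, 6], [2, 4, 6], [3, 5]]⟩,
   -- 631:2
   ⟨[[], [], [], [e 1 2], [e 1 3], [e 2 4]],
    1/12, [6, 5, 9, 11, 15, 16],
    [[], [1, 2, 3, 6], [1, 2, 5, 6], [1, 3, 4, 6], [1, 4, 5, 6], [2, 3, 4, 5], [2, 4], [3, 5]]⟩,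
   -- 631:3
   ⟨[[], [], [], [e 1 2], [e 1 3], [e 2 3, e 1 4]],
    1/8, [3, 5, 6, 8, 9, 11],
    [[], [1, 2, 5, 6], [1, 4, 5], [2, 4, 6]]⟩,
   -- 631:4
   ⟨[[], [], [], [e 1 2], [e 1 3], [e 2 4, e 1 5]],
    2/11, [2, 3, 4, 5, 6, 8],
    [[], [1, 2, 3, 6], [1, 3, 4, 6], [2, 4]]⟩,
   -- 631:5a
   ⟨[[], [], [], [e 1 2], [e 1 3], [e 3 5, e 2 4]],
    1/2, [1, 1, 1, 2, 2, 3],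
    [[], [1, 2, 3, 6], [1, 2, 5, 6], [1, 3, 4, 6], [1, 4, 5, 6], [2, 3, 4, 5], [2, 4], [3, 5]]⟩,
   -- 631:5b
   ⟨[[], [], [], [neg 1 2], [e 1 3], [e 2 4, e 3 5]],
    1/2, [1, 1, 1, 2, 2, 3],
    [[], [1, 2, 3, 6], [1, 2, 5, 6], [1, 3, 4, 6], [1, 4, 5, 6], [2, 3, 4, 5], [2, 4], [3, 5]]⟩,
   -- 631:6
   ⟨[[], [], [], [e 1 2], [e 1 3], [e 3 4, e 2 5]],
    1/2, [1, 1, 1, 2, 2, 3],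
    [[], [1, 2, 3, 6], [1, 2, 5], [1, 3, 4], [1, 4, 5, 6], [2, 3, 4, 5], [2, 4, 6], [3, 5, 6]]⟩,
   -- 63:1
   ⟨[[], [], [], [e 1 2], [e 1 3], [e 2 3]],
    3/5, [1, 1, 1, 2, 2, 2],
    [[], [1, 2, 3], [1, 2, 5, 6], [1, 3, 4, 6], [1, 4, 5], [2, 3, 4, 5], [2, 4, 6], [3, 5, 6]]⟩,
   -- 621:3
   ⟨[[], [], [], [], [e 1 2], [e 1 5, e 3 4]],
    1/12, [5, 8, 9, 9, 13, 18],
    [[], [1, 2, 3, 6], [1, 2, 4, 6], [1, 3, 4, 5], [1, 5], [2, 3, 5, 6], [2, 4, 5, 6], [3, 4]]⟩,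
   -- 62:3
   ⟨[[], [], [], [], [e 1 2], [e 1 3, e 2 4]],
    1/5, [3, 3, 4, 4, 6, 7],
    [[], [1, 2, 3, 4], [1, 2, 6], [1, 3, 5], [1, 4, 5, 6], [2, 3, 5, 6], [2, 4, 5], [3, 4, 6]]⟩,
   -- 62:4a
   ⟨[[], [], [], [], [e 1 3, e 2 4], [e 3 4, e 1 2]],
    2/3, [1, 1, 1, 1, 2, 2],
    [[], [1, 2, 3, 4], [1, 2, 5], [1, 3, 6], [1, 4, 5, 6], [2, 3, 5, 6], [2, 4, 6], [3, 4, 5]]⟩,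
   -- 62:4b
   ⟨[[], [], [], [], [e 2 4, neg 1 3], [e 3 4, e 1 2]],
    2/3, [1, 1, 1, 1, 2, 2],
    [[], [1, 2, 3, 4], [1, 2, 5], [1, 3, 6], [1, 4, 5, 6], [2, 3, 5, 6], [2, 4, 6], [3, 4, 5]]⟩
  ]

end NiceNilsoliton

namespace NiceNilsoliton

/-! ### Structure constants -/

section StructureConstants

variable {L : Type*} [LieRing L] [LieAlgebra ℝ L] {n : ℕ}

/-- The structure constants of a Lie algebra with respect to a basis. -/
noncomputable def sc (b : Basis (Fin n) ℝ L) (i j k : Fin n) : ℝ := b.repr ⁅b i, b j⁆ k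

variable (b : Basis (Fin n) ℝ L)

lemma lie_basis (i j : Fin n) : ⁅b i, b j⁆ = ∑ k, sc b i j k • b k := (b.sum_repr _).symm

lemma sc_skew (i j k : Fin n) : sc b j i k = -sc b i j k := by
  simp only [sc]
  rw [← lie_skew, map_neg, Finsupp.neg_apply]

lemma sc_self (i k : Fin n) : sc b i i k = 0 := by simp [sc]

lemma repr_map_eq_sum (f : L →ₗ[ℝ] L) (x : L) (k : Fin n) :
    b.repr (f x) k = ∑ i, b.repr x i * b.repr (f (b i)) k := by
  conv_lhs => rw [← b.sum_repr x]
  simp only [map_sum, map_smul, Finsupp.coe_finsetSum, Finset.sum_apply, Finsupp.smul_apply,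
    smul_eq_mul]

lemma repr_lie_basis_left (x : L) (i k : Fin n) :
    b.repr ⁅b i, x⁆ k = ∑ j, b.repr x j * sc b i j k :=
  repr_map_eq_sum b (LieAlgebra.ad ℝ L (b i)) x k

lemma sc_jacobi (i j k u : Fin n) :
    ∑ w, (sc b i j w * sc b w k u + sc b j k w * sc b w i u + sc b k i w * sc b w j u) = 0 := by
  have h := lie_jacobi (b i) (b j) (b k)
  have h' := congrArg (fun x => b.repr x u) h
  have e : ∀ p q r : Fin n, b.repr ⁅b r, ⁅b p, b q⁆⁆ u = -∑ w, sc b p q w * sc b w r u := by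
    intro p q r
    rw [repr_lie_basis_left, ← Finset.sum_neg_distrib]
    refine Finset.sum_congr rfl fun w _ => ?_
    rw [sc_skew b w r u, ← sc]
    ring
  simp only [map_add, Finsupp.add_apply, map_zero, Finsupp.zero_apply, e] at h'
  simp only [Finset.sum_add_distrib]
  linarith

/-- Nice structure constants for which the basis is ordered compatibly with the lower central
series. -/
structure NiceTriangular {R : Type*} [Zero R] (c : Fin n → Fin n → Fin n → R) : Prop where
  tgt_unique : ∀ i j k k', c i j k ≠ 0 → c i j k' ≠ 0 → k = k'
  src_unique : ∀ i j j' k, c i j k ≠ 0 → c i j' k ≠ 0 → j = j'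
  lt_tgt : ∀ i j k, c i j k ≠ 0 → i < k ∧ j < k

end StructureConstants

/-! ### The Ricci operator of a diagonal metric -/

section Ricci

variable {L : Type*} [LieRing L] [LieAlgebra ℝ L] {n : ℕ} (b : Basis (Fin n) ℝ L)

lemma diagMetric_apply (g : Fin n → ℝ) (x y : L) :
    diagMetric b g x y = ∑ i, g i * (b.repr x i * b.repr y i) := by
  simp [diagMetric, LinearMap.BilinForm.linMulLin]

lemma diagMetric_basis_right (g : Fin n → ℝ) (x : L) (k : Fin n) :
    diagMetric b g x (b k) = g k * b.repr x k := by
  rw [diagMetric_apply, Finset.sum_eq_single k] <;> simp +contextual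

lemma diagMetric_comm (g : Fin n → ℝ) (x y : L) :
    diagMetric b g x y = diagMetric b g y x := by
  simp only [diagMetric_apply]
  exact Finset.sum_congr rfl fun i _ => by ring

/-- The Christoffel symbols of a diagonal metric. -/
noncomputable def christoffel (g : Fin n → ℝ) (i j k : Fin n) : ℝ :=
  (sc b i j k + sc b k j i * (g i / g k) + sc b k i j * (g j / g k)) / 2

variable {b}

lemma IsLeviCivita.repr_eq {g : Fin n → ℝ} (hg : ∀ i, g i ≠ 0) {D : L →ₗ[ℝ] L →ₗ[ℝ] L}
    (h : IsLeviCivita (diagMetric b g) D) (i j k : Fin n) :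
    b.repr (D (b i) (b j)) k = christoffel b g i j k := by
  have tor : ∀ i j k, b.repr (D (b i) (b j)) k - b.repr (D (b j) (b i)) k = sc b i j k := by
    intro i j k
    rw [sc, ← h.torsionFree, map_sub, Finsupp.sub_apply]
  have met : ∀ i j k, g k * b.repr (D (b i) (b j)) k + g j * b.repr (D (b i) (b k)) j = 0 := by
    intro i j k
    have := h.metric (b i) (b j) (b k)
    rwa [diagMetric_basis_right, diagMetric_comm, diagMetric_basis_right] at this
  have hk := hg k
  have h1 := tor i j k
  have h2 := tor k j i
  have h3 := tor k i j
  have m1 := met i j k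
  have m2 := met j i k
  have m3 := met k i j
  rw [christoffel]
  field_simp
  linear_combination g k * h1 + g i * h2 + g j * h3 + m1 + m2 - m3

lemma sum_sum_congr_symm {ι : Type*} [Fintype ι] {F G : ι → ι → ℝ}
    (h : ∀ x w, F x w + F w x = G x w + G w x) : ∑ x, ∑ w, F x w = ∑ x, ∑ w, G x w := by
  have e : ∀ H : ι → ι → ℝ, 2 * ∑ x, ∑ w, H x w = ∑ x, ∑ w, (H x w + H w x) := by
    intro H
    simp only [Finset.sum_add_distrib]
    rw [Finset.sum_comm (f := fun x w => H w x)]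
    ring
  have := e F
  simp only [h, ← e G] at this
  linarith

variable (b) in
/-- The Ricci tensor of a diagonal metric in terms of the structure constants. -/
noncomputable def ricciFormula (g : Fin n → ℝ) (y z : Fin n) : ℝ :=
  ∑ x, ∑ w, (-(1 / 2) * (sc b x y w * sc b x z w * (g w / g x)) +
    1 / 4 * (sc b w x y * sc b w x z * (g y * g z / (g x * g w))))

lemma ricciTensor_basis (hb : NiceTriangular (sc b)) {g : Fin n → ℝ} (hg : ∀ i, g i ≠ 0)
    {D : L →ₗ[ℝ] L →ₗ[ℝ] L} (h : IsLeviCivita (diagMetric b g) D) (y z : Fin n) :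
    ricciTensor D (b y) (b z) = ricciFormula b g y z := by
  set G : Fin n → Fin n → Fin n → ℝ := christoffel b g with hG
  have hGr : ∀ i j k, b.repr (D (b i) (b j)) k = G i j k := h.repr_eq hg
  have expand : ∀ (x : Fin n) (v : L) (k : Fin n),
      b.repr (D (b x) v) k = ∑ w, b.repr v w * G x w k := by
    intro x v k
    simp only [repr_map_eq_sum b (D (b x)) v k, hGr]
  have expand' : ∀ (v : L) (w k : Fin n),
      b.repr (D v (b w)) k = ∑ x, b.repr v x * G x w k := by
    intro v w k
    simp only [← hGr]
    exact repr_map_eq_sum b (D.flip (b w)) v k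
  have tor : ∀ i j k, G i j k - G j i k = sc b i j k := by
    intro i j k
    rw [← hGr, ← hGr, sc, ← h.torsionFree, map_sub, Finsupp.sub_apply]
  have skew : ∀ i j, G i j j = 0 := by
    intro i j
    have h0 : sc b j j i = 0 := sc_self b j i
    simp only [hG, christoffel, h0, sc_skew b i j j, div_self (hg j)]
    ring
  have tr0 : ∀ w, ∑ x, G x w x = 0 := by
    intro w
    refine Finset.sum_eq_zero fun x _ => ?_
    have h1 := tor x w x
    have h2 : sc b x w x = 0 := by
      by_contra hne
      exact lt_irrefl _ (hb.lt_tgt _ _ _ hne).1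
    rw [skew, h2] at h1
    linarith
  have key : ricciTensor D (b y) (b z) = -∑ x, ∑ w, G x z w * G w y x := by
    rw [ricciTensor, LinearMap.trace_eq_matrix_trace ℝ b, Matrix.trace]
    have e1 : ∀ x, (LinearMap.toMatrix b b (curvature D (b y) (b z))).diag x =
        ∑ w, G y z w * G x w x - ∑ w, G x z w * G y w x - ∑ w, sc b x y w * G w z x := by
      intro x
      rw [Matrix.diag_apply, LinearMap.toMatrix_apply]
      change b.repr (D (b x) (D (b y) (b z)) - D (b y) (D (b x) (b z)) - D ⁅b x, b y⁆ (b z)) x = _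
      rw [map_sub, map_sub, Finsupp.sub_apply, Finsupp.sub_apply, expand, expand, expand']
      simp only [hGr, sc]
    simp only [e1, Finset.sum_sub_distrib]
    have e2 : ∑ x, ∑ w, G y z w * G x w x = 0 := by
      rw [Finset.sum_comm]
      refine Finset.sum_eq_zero fun w _ => ?_
      rw [← Finset.mul_sum, tr0, mul_zero]
    have e3 : ∑ x, ∑ w, sc b x y w * G w z x = ∑ x, ∑ w, sc b w y x * G x z w :=
      Finset.sum_comm
    rw [e2, e3, zero_sub, ← neg_add', ← Finset.sum_add_distrib]
    refine congrArg Neg.neg (Finset.sum_congr rfl fun x _ => ?_)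
    rw [← Finset.sum_add_distrib]
    refine Finset.sum_congr rfl fun w _ => ?_
    linear_combination (-G x z w) * tor w y x
  rw [key, ricciFormula, ← Finset.sum_neg_distrib]
  simp only [← Finset.sum_neg_distrib]
  refine sum_sum_congr_symm fun x w => ?_
  have z1 : ∀ p q r s : Fin n, sc b p r q * sc b q s p = 0 := by
    intro p q r s
    by_contra hne
    have := (hb.lt_tgt _ _ _ (left_ne_zero_of_mul hne)).1
    exact lt_asymm this (hb.lt_tgt _ _ _ (right_ne_zero_of_mul hne)).1
  have a1 := z1 x w z y
  have a2 := z1 w x z y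
  have s1 := sc_skew b x w z
  have s2 := sc_skew b x w y
  have gx := hg x
  have gw := hg w
  simp only [hG, christoffel, s1, s2]
  field_simp
  linear_combination (-8 * g x * g w) * a1 + (-8 * g x * g w) * a2

variable (b) in
/-- The Levi-Civita connection of a diagonal metric. -/
noncomputable def leviCivita (g : Fin n → ℝ) : L →ₗ[ℝ] L →ₗ[ℝ] L :=
  b.constr ℝ fun i => b.constr ℝ fun j => ∑ k, christoffel b g i j k • b k

lemma leviCivita_basis (g : Fin n → ℝ) (i j : Fin n) :
    leviCivita b g (b i) (b j) = ∑ k, christoffel b g i j k • b k := by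
  simp [leviCivita]

lemma repr_leviCivita (g : Fin n → ℝ) (i j k : Fin n) :
    b.repr (leviCivita b g (b i) (b j)) k = christoffel b g i j k := by
  rw [leviCivita_basis]
  simp [Finsupp.finsetSum_apply, Finsupp.single_apply]

lemma isLeviCivita_leviCivita {g : Fin n → ℝ} (hg : ∀ i, g i ≠ 0) :
    IsLeviCivita (diagMetric b g) (leviCivita b g) where
  torsionFree := by
    have : leviCivita b g - (leviCivita b g).flip = (LieAlgebra.ad ℝ L : L →ₗ[ℝ] End ℝ L) := by
      refine b.ext fun i => b.ext fun j => b.repr.injective (Finsupp.ext fun k => ?_)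
      have := sc_skew b i j k
      have h2 := sc_skew b k j i
      have h3 := sc_skew b k i j
      simp only [LinearMap.sub_apply, LinearMap.flip_apply, map_sub, Finsupp.sub_apply,
        repr_leviCivita]
      change _ = sc b i j k
      rw [christoffel, christoffel, this]
      ring
    intro x y
    have := congrArg (fun f => f x y) this
    simpa using this
  metric := by
    have step : ∀ i j k, diagMetric b g (leviCivita b g (b i) (b j)) (b k) +
        diagMetric b g (b j) (leviCivita b g (b i) (b k)) = 0 := by
      intro i j k
      rw [diagMetric_basis_right, diagMetric_comm, diagMetric_basis_right, repr_leviCivita,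
        repr_leviCivita, christoffel, christoffel, sc_skew b i k j, sc_skew b k i j,
        sc_skew b j i k, sc_skew b j k i]
      have := hg k
      have := hg j
      field_simp
      ring
    intro x y z
    have h1 : ∀ i j, diagMetric b g (leviCivita b g (b i) (b j)) +
        (diagMetric b g (b j)) ∘ₗ (leviCivita b g (b i)) = 0 := by
      intro i j
      refine b.ext fun k => ?_
      simpa using step i j k
    have h2 : ∀ i z, (diagMetric b g).flip z ∘ₗ (leviCivita b g (b i)) +
        (diagMetric b g).flip (leviCivita b g (b i) z) = 0 := by
      intro i z
      refine b.ext fun j => ?_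
      simpa using congrArg (fun f => f z) (h1 i j)
    have h3 : (diagMetric b g).flip z ∘ₗ ((leviCivita b g).flip y) +
        (diagMetric b g y) ∘ₗ ((leviCivita b g).flip z) = 0 := by
      refine b.ext fun i => ?_
      simpa using congrArg (fun f => f y) (h2 i z)
    simpa using congrArg (fun f => f x) h3

/-- The Ricci tensor as a bilinear form. -/
noncomputable def ricciBilin (D : L →ₗ[ℝ] L →ₗ[ℝ] L) : LinearMap.BilinForm ℝ L :=
  LinearMap.mk₂ ℝ (ricciTensor D)
    (fun y y' z => by
      rw [ricciTensor, ricciTensor, ricciTensor, ← map_add]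
      congr 1
      ext x
      simp only [curvature, LinearMap.coe_mk, AddHom.coe_mk, LinearMap.add_apply, map_add, lie_add]
      abel)
    (fun a y z => by
      rw [ricciTensor, ricciTensor, ← map_smul]
      congr 1
      ext x
      simp only [curvature, LinearMap.coe_mk, AddHom.coe_mk, LinearMap.smul_apply, map_smul,
        lie_smul, smul_sub])
    (fun y z z' => by
      rw [ricciTensor, ricciTensor, ricciTensor, ← map_add]
      congr 1
      ext x
      simp only [curvature, LinearMap.coe_mk, AddHom.coe_mk, LinearMap.add_apply, map_add]
      abel)
    (fun a y z => by
      rw [ricciTensor, ricciTensor, ← map_smul]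
      congr 1
      ext x
      simp only [curvature, LinearMap.coe_mk, AddHom.coe_mk, LinearMap.smul_apply, map_smul,
        smul_sub])

lemma isRicciOperator_iff (hb : NiceTriangular (sc b)) {g : Fin n → ℝ} (hg : ∀ i, g i ≠ 0)
    (R : Module.End ℝ L) :
    IsRicciOperator (diagMetric b g) R ↔
      ∀ y z, diagMetric b g (R (b y)) (b z) = ricciFormula b g y z := by
  constructor
  · rintro ⟨D, hD, h⟩ y z
    rw [h, ricciTensor_basis hb hg hD]
  · intro h
    have hD := isLeviCivita_leviCivita (b := b) hg
    refine ⟨leviCivita b g, hD, ?_⟩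
    have : (diagMetric b g) ∘ₗ R = ricciBilin (leviCivita b g) := by
      refine b.ext fun y => b.ext fun z => ?_
      rw [LinearMap.comp_apply, h, ← ricciTensor_basis hb hg hD]
      rfl
    intro y z
    exact congrArg (fun f => f y z) this

lemma ricciFormula_off_diag (hb : NiceTriangular (sc b)) (g : Fin n → ℝ) {y z : Fin n}
    (hyz : y ≠ z) : ricciFormula b g y z = 0 := by
  refine Finset.sum_eq_zero fun x _ => Finset.sum_eq_zero fun w _ => ?_
  have h1 : sc b x y w * sc b x z w = 0 := by
    by_contra hne
    exact hyz (hb.src_unique _ _ _ _ (left_ne_zero_of_mul hne) (right_ne_zero_of_mul hne))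
  have h2 : sc b w x y * sc b w x z = 0 := by
    by_contra hne
    exact hyz (hb.tgt_unique _ _ _ _ (left_ne_zero_of_mul hne) (right_ne_zero_of_mul hne))
  rw [h1, h2]
  ring

lemma diagOp_basis (v : Fin n → ℝ) (i : Fin n) : diagOp b v (b i) = v i • b i := by
  simp [diagOp]

/-- The incidence vector `ε_i + ε_j - ε_k` of an arrow `{i, j} → k`. -/
def root (a : Fin n × Fin n × Fin n) (h : Fin n) : ℝ :=
  (if a.1 = h then 1 else 0) + (if a.2.1 = h then 1 else 0) - (if a.2.2 = h then 1 else 0)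

/-- The arrows `{i, j} → k` with `i < j`, given by the nonzero structure constants. -/
noncomputable def arrows (c : Fin n → Fin n → Fin n → ℝ) : Finset (Fin n × Fin n × Fin n) :=
  open Classical in Finset.univ.filter fun a => a.1 < a.2.1 ∧ c a.1 a.2.1 a.2.2 ≠ 0

lemma mem_arrows {c : Fin n → Fin n → Fin n → ℝ} {a : Fin n × Fin n × Fin n} :
    a ∈ arrows c ↔ a.1 < a.2.1 ∧ c a.1 a.2.1 a.2.2 ≠ 0 := by
  simp [arrows]

lemma sum_eq_two_mul_sum_arrows {c F : Fin n → Fin n → Fin n → ℝ}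
    (hF : ∀ i j k, F i j k = F j i k) (h0 : ∀ i k, F i i k = 0)
    (hs : ∀ i j k, c i j k = 0 → F i j k = 0) :
    ∑ i, ∑ j, ∑ k, F i j k = 2 * ∑ a ∈ arrows c, F a.1 a.2.1 a.2.2 := by
  classical
  have e1 : ∑ a ∈ arrows c, F a.1 a.2.1 a.2.2
      = ∑ i, ∑ j, ∑ k, if i < j then F i j k else 0 := by
    rw [arrows, Finset.sum_filter, Fintype.sum_prod_type]
    refine Finset.sum_congr rfl fun i _ => ?_
    rw [Fintype.sum_prod_type]
    refine Finset.sum_congr rfl fun j _ => Finset.sum_congr rfl fun k _ => ?_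
    by_cases hij : i < j
    · by_cases hc : c i j k = 0
      · simp [hc, hs i j k hc]
      · simp [hc, hij]
    · simp [hij]
  rw [e1, two_mul]
  conv_rhs => lhs; rw [Finset.sum_comm]
  simp only [← Finset.sum_add_distrib]
  refine Finset.sum_congr rfl fun i _ => Finset.sum_congr rfl fun j _ =>
    Finset.sum_congr rfl fun k _ => ?_
  rcases lt_trichotomy i j with h | h | h
  · simp [h, h.not_gt]
  · subst h; simp [h0]
  · simp [h, h.not_gt, hF j i k]

/-- The diagonal metric `g` has Ricci operator `-½ id + ½ v^D` if and only if it solves a system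
that is linear in the quantities `c_{ij}^k ^ 2 g_k / (g_i g_j)`. -/
theorem isRicciOperator_diag_iff (hb : NiceTriangular (sc b)) {g : Fin n → ℝ}
    (hg : ∀ i, g i ≠ 0) (v : Fin n → ℝ) :
    IsRicciOperator (diagMetric b g)
      (-(1 / 2 : ℝ) • (1 : Module.End ℝ L) + (1 / 2 : ℝ) • diagOp b v) ↔
    ∀ h, ∑ a ∈ arrows (sc b), sc b a.1 a.2.1 a.2.2 ^ 2 * (g a.2.2 / (g a.1 * g a.2.1)) * root a h
      = 1 - v h := by
  rw [isRicciOperator_iff hb hg]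
  have lhs : ∀ y z, diagMetric b g ((-(1 / 2 : ℝ) • (1 : Module.End ℝ L)
      + (1 / 2 : ℝ) • diagOp b v) (b y)) (b z) = if y = z then g y * ((v y - 1) / 2) else 0 := by
    intro y z
    rw [diagMetric_basis_right]
    simp only [LinearMap.add_apply, LinearMap.smul_apply, Module.End.one_apply, diagOp_basis,
      map_add, map_smul, Finsupp.add_apply, Finsupp.smul_apply, Basis.repr_self,
      Finsupp.single_apply, smul_eq_mul]
    split_ifs with h
    · subst h; ring
    · ring
  set X : Fin n → Fin n → Fin n → ℝ :=
    fun i j k => sc b i j k ^ 2 * (g k / (g i * g j)) with hX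
  have hXs : ∀ i j k, X i j k = X j i k := by
    intro i j k
    simp only [hX]
    rw [sc_skew b j i k, mul_comm (g i)]
    ring
  have key : ∀ h, ∑ a ∈ arrows (sc b), X a.1 a.2.1 a.2.2 * root a h
      = -2 * (ricciFormula b g h h / g h) := by
    intro h
    have e := sum_eq_two_mul_sum_arrows (c := sc b) (F := fun i j k => X i j k * root (i, j, k) h)
      (fun i j k => by simp only [hXs i j k, root]; ring)
      (fun i k => by simp [hX, sc_self])
      (fun i j k hc => by simp [hX, hc])
    have e' : ∑ i, ∑ j, ∑ k, X i j k * root (i, j, k) h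
        = 2 * (∑ x, ∑ w, X x h w) - ∑ x, ∑ w, X w x h := by
      have t1 : ∑ i, ∑ j, ∑ k, X i j k * (if i = h then (1 : ℝ) else 0) = ∑ x, ∑ w, X x h w := by
        rw [Finset.sum_eq_single h (by intro i _ hi; simp [hi]) (by simp)]
        exact Finset.sum_congr rfl fun x _ => Finset.sum_congr rfl fun w _ => by simp [hXs h x w]
      have t2 : ∑ i, ∑ j, ∑ k, X i j k * (if j = h then (1 : ℝ) else 0) = ∑ x, ∑ w, X x h w := by
        refine Finset.sum_congr rfl fun i _ => ?_
        rw [Finset.sum_eq_single h (by intro j _ hj; simp [hj]) (by simp)]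
        simp
      have t3 : ∑ i, ∑ j, ∑ k, X i j k * (if k = h then (1 : ℝ) else 0) = ∑ x, ∑ w, X w x h := by
        simp only [mul_ite, mul_one, mul_zero, Finset.sum_ite_eq', Finset.mem_univ, if_true]
        exact Finset.sum_comm
      simp only [root, mul_sub, mul_add, Finset.sum_sub_distrib, Finset.sum_add_distrib]
      rw [t1, t2, t3]; ring
    have e2 : ricciFormula b g h h / g h
        = -(1 / 2) * (∑ x, ∑ w, X x h w) + 1 / 4 * ∑ x, ∑ w, X w x h := by
      simp only [ricciFormula, Finset.mul_sum, Finset.sum_div, ← Finset.sum_add_distrib]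
      refine Finset.sum_congr rfl fun x _ => Finset.sum_congr rfl fun w _ => ?_
      have := hg h
      have := hg x
      have := hg w
      simp only [hX]
      field_simp
    rw [e2]
    linarith
  have hkey : ∀ h, (∑ a ∈ arrows (sc b), X a.1 a.2.1 a.2.2 * root a h = 1 - v h) ↔
      g h * ((v h - 1) / 2) = ricciFormula b g h h := by
    intro h
    rw [key]
    have := hg h
    constructor
    · intro e
      field_simp at e
      linarith
    · intro e
      rw [← e]
      field_simp
      ring
  constructor
  · intro H h
    refine (hkey h).2 ?_
    rw [← H h h, lhs, if_pos rfl]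
  · intro H y z
    rw [lhs]
    split_ifs with hyz
    · subst hyz
      exact (hkey y).1 (H y)
    · exact (ricciFormula_off_diag hb g hyz).symm

end Ricci

/-! ### Niceness, nilpotency and irreducibility in terms of structure constants -/

section Characterizations

variable {L : Type*} [LieRing L] [LieAlgebra ℝ L] {n : ℕ} {b : Basis (Fin n) ℝ L}

lemma repr_lie_eq_sum (b : Basis (Fin n) ℝ L) (x y : L) (k : Fin n) :
    b.repr ⁅x, y⁆ k = ∑ j, ∑ i, b.repr y j * (b.repr x i * sc b i j k) := by
  rw [show ⁅x, y⁆ = LieAlgebra.ad ℝ L x y from rfl, repr_map_eq_sum]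
  refine Finset.sum_congr rfl fun j _ => ?_
  rw [← Finset.mul_sum, LieAlgebra.ad_apply, ← lie_skew,
    show ⁅b j, x⁆ = LieAlgebra.ad ℝ L (b j) x from rfl, map_neg, Finsupp.neg_apply,
    repr_map_eq_sum, ← Finset.sum_neg_distrib]
  refine congrArg _ (Finset.sum_congr rfl fun i _ => ?_)
  rw [LieAlgebra.ad_apply, ← sc, sc_skew b i j k]
  ring

lemma exists_smul_iff_unique {c : Fin n → ℝ} (j : Fin n) :
    (∃ (k : Fin n) (t : ℝ), ∀ l, c l = t * if k = l then 1 else 0) ↔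
      ∀ k k', c k ≠ 0 → c k' ≠ 0 → k = k' := by
  constructor
  · rintro ⟨k₀, t, h⟩ k k' hk hk'
    rw [h] at hk hk'
    have := right_ne_zero_of_mul hk
    have := right_ne_zero_of_mul hk'
    simp_all
  · intro h
    by_cases h0 : ∃ k, c k ≠ 0
    · obtain ⟨k, hk⟩ := h0
      refine ⟨k, c k, fun l => ?_⟩
      split_ifs with hl
      · simp [hl]
      · by_contra hne
        exact hl (h k l hk (by simpa using hne))
    · push Not at h0
      exact ⟨j, 0, by simp [h0]⟩

lemma isNice_iff : IsNice b ↔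
    (∀ i j k k', sc b i j k ≠ 0 → sc b i j k' ≠ 0 → k = k') ∧
    (∀ i j j' k, sc b i j k ≠ 0 → sc b i j' k ≠ 0 → j = j') := by
  have h1 : ∀ i j, (∃ (k : Fin n) (c : ℝ), ⁅b i, b j⁆ = c • b k) ↔
      ∀ k k', sc b i j k ≠ 0 → sc b i j k' ≠ 0 → k = k' := by
    intro i j
    rw [← exists_smul_iff_unique i]
    refine exists_congr fun k => exists_congr fun t => ?_
    rw [← b.repr.injective.eq_iff, DFunLike.ext_iff]
    simp [sc, Finsupp.single_apply]
  have h2 : ∀ i k, (∃ (j : Fin n) (c : ℝ), interiorDiff b i k = c • b.coord j) ↔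
      ∀ j j', sc b i j k ≠ 0 → sc b i j' k ≠ 0 → j = j' := by
    intro i k
    have e : ∀ l, interiorDiff b i k (b l) = -sc b i l k := by
      intro l
      simp [interiorDiff, sc]
    have : (∀ j j', sc b i j k ≠ 0 → sc b i j' k ≠ 0 → j = j') ↔
        ∀ j j', -sc b i j k ≠ 0 → -sc b i j' k ≠ 0 → j = j' := by simp
    rw [this, ← exists_smul_iff_unique i]
    refine exists_congr fun j => exists_congr fun t => ?_
    constructor
    · intro h l
      rw [← e, h]
      simp [Finsupp.single_apply, eq_comm]
    · intro h
      refine b.ext fun l => ?_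
      rw [e, h]
      simp [Finsupp.single_apply, eq_comm]
  constructor
  · rintro ⟨hb, hi⟩
    exact ⟨fun i j => (h1 i j).1 (hb i j), fun i j j' k => (h2 i k).1 (hi i k) j j'⟩
  · rintro ⟨hb, hi⟩
    exact ⟨fun i j => (h1 i j).2 (hb i j), fun i k => (h2 i k).2 fun j j' => hi i j j' k⟩

lemma NiceTriangular.isNice (hb : NiceTriangular (sc b)) : IsNice b :=
  isNice_iff.2 ⟨hb.tgt_unique, hb.src_unique⟩

lemma NiceTriangular.isNilpotent (hb : NiceTriangular (sc b)) : LieRing.IsNilpotent L := by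
  have key : ∀ m, ∀ x ∈ LieModule.lowerCentralSeries ℝ L L m, ∀ k : Fin n, (k : ℕ) < m →
      b.repr x k = 0 := by
    intro m
    induction m with
    | zero => intro x _ k hk; exact absurd hk (Nat.not_lt_zero _)
    | succ m ih =>
      intro x hx k hk
      rw [LieModule.lowerCentralSeries_succ, ← LieSubmodule.mem_toSubmodule,
        LieSubmodule.lieIdeal_oper_eq_linear_span'] at hx
      induction hx using Submodule.span_induction with
      | zero => simp
      | add y z _ _ hy hz => rw [map_add, Finsupp.add_apply, hy, hz, add_zero]
      | smul a y _ hy => rw [map_smul, Finsupp.smul_apply, hy, smul_zero]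
      | mem y hy =>
        obtain ⟨p, -, q, hq, rfl⟩ := hy
        rw [repr_lie_eq_sum]
        refine Finset.sum_eq_zero fun j _ => Finset.sum_eq_zero fun i _ => ?_
        by_cases hc : sc b i j k = 0
        · rw [hc, mul_zero, mul_zero]
        · have := (hb.lt_tgt i j k hc).2
          rw [ih q hq j (by omega), zero_mul]
  suffices hn : LieModule.lowerCentralSeries ℝ L L n = ⊥ from LieModule.IsNilpotent.mk L hn
  rw [eq_bot_iff]
  intro x hx
  rw [LieSubmodule.mem_bot]
  refine b.repr.injective (Finsupp.ext fun k => ?_)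
  rw [key n x hx k k.2]
  simp

/-- A nice basis of a nilpotent Lie algebra can be ordered compatibly with the lower central
series. -/
lemma exists_depth [LieRing.IsNilpotent L] (hb : IsNice b) :
    ∃ ρ : Fin n → ℕ, ∀ i j k, sc b i j k ≠ 0 → ρ i < ρ k ∧ ρ j < ρ k := by
  classical
  obtain ⟨N, hN⟩ := LieModule.IsNilpotent.nilpotent (R := ℝ) (L := L) (M := L)
  have hlt : ∀ i m, b i ∈ LieModule.lowerCentralSeries ℝ L L m → m ≤ N := by
    intro i m hm
    by_contra hlt
    have h1 := LieModule.antitone_lowerCentralSeries ℝ L L (not_le.1 hlt).le hm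
    rw [hN, LieSubmodule.mem_bot] at h1
    exact b.ne_zero i h1
  refine ⟨fun i => Nat.findGreatest (fun m => b i ∈ LieModule.lowerCentralSeries ℝ L L m) N, ?_⟩
  have main : ∀ i j k, sc b i j k ≠ 0 →
      Nat.findGreatest (fun m => b j ∈ LieModule.lowerCentralSeries ℝ L L m) N <
      Nat.findGreatest (fun m => b k ∈ LieModule.lowerCentralSeries ℝ L L m) N := by
    intro i j k hc
    obtain ⟨k', c, hk'⟩ := hb.bracket i j
    have hkk : k' = k := by
      rw [sc, hk'] at hc
      by_contra hne
      simp [hne] at hc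
    subst hkk
    have hc0 : c ≠ 0 := by
      rintro rfl
      rw [sc, hk'] at hc
      simp at hc
    set m := Nat.findGreatest (fun m => b j ∈ LieModule.lowerCentralSeries ℝ L L m) N
    have hm : b j ∈ LieModule.lowerCentralSeries ℝ L L m :=
      Nat.findGreatest_spec (P := fun m => b j ∈ LieModule.lowerCentralSeries ℝ L L m)
        (Nat.zero_le N) (by simp)
    have h1 : ⁅b i, b j⁆ ∈ LieModule.lowerCentralSeries ℝ L L (m + 1) := by
      rw [LieModule.lowerCentralSeries_succ]
      exact LieSubmodule.lie_mem_lie (LieSubmodule.mem_top _) hm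
    have h2 : b k' ∈ LieModule.lowerCentralSeries ℝ L L (m + 1) := by
      have := SMulMemClass.smul_mem c⁻¹ h1
      rwa [hk', smul_smul, inv_mul_cancel₀ hc0, one_smul] at this
    exact Nat.le_findGreatest (hlt _ _ h2) h2
  intro i j k hc
  refine ⟨main j i k ?_, main i j k hc⟩
  rw [sc_skew]
  exact neg_ne_zero.2 hc

lemma spansIdeal_iff (s : Set (Fin n)) :
    SpansIdeal b s ↔ ∀ i j k, i ∈ s → sc b i j k ≠ 0 → k ∈ s := by
  have mem : ∀ x, x ∈ Submodule.span ℝ (b '' s) ↔ ∀ k, b.repr x k ≠ 0 → k ∈ s := by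
    intro x
    rw [b.mem_span_image]
    simp [Set.subset_def]
  constructor
  · rintro ⟨I, hI⟩ i j k hi hc
    have hbi : b i ∈ I := by
      rw [← LieSubmodule.mem_toSubmodule, hI]
      exact Submodule.subset_span ⟨i, hi, rfl⟩
    have : ⁅b i, b j⁆ ∈ I := lie_mem_left ℝ L I (b i) (b j) hbi
    rw [← LieSubmodule.mem_toSubmodule, hI, mem] at this
    exact this k hc
  · intro h
    refine ⟨{ Submodule.span ℝ (b '' s) with
      lie_mem := ?_ }, rfl⟩
    intro x y hy
    change y ∈ Submodule.span ℝ (b '' s) at hy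
    change ⁅x, y⁆ ∈ Submodule.span ℝ (b '' s)
    rw [mem] at hy ⊢
    intro k hk
    rw [repr_lie_eq_sum] at hk
    obtain ⟨j, -, hj⟩ := Finset.exists_ne_zero_of_sum_ne_zero hk
    obtain ⟨i, -, hi⟩ := Finset.exists_ne_zero_of_sum_ne_zero hj
    refine h j i k (hy j (left_ne_zero_of_mul hi)) ?_
    rw [sc_skew, neg_ne_zero]
    exact right_ne_zero_of_mul (right_ne_zero_of_mul hi)

lemma isIrreducible_iff : IsIrreducible b ↔
    ∀ s : Set (Fin n), (∀ i j k, sc b i j k ≠ 0 → (i ∈ s ↔ k ∈ s)) → s.Nonempty → sᶜ = ∅ := by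
  have e : ∀ s : Set (Fin n), (SpansIdeal b s ∧ SpansIdeal b sᶜ) ↔
      ∀ i j k, sc b i j k ≠ 0 → (i ∈ s ↔ k ∈ s) := by
    intro s
    rw [spansIdeal_iff, spansIdeal_iff]
    constructor
    · rintro ⟨h1, h2⟩ i j k hc
      refine ⟨fun hi => h1 i j k hi hc, fun hk => ?_⟩
      by_contra hi
      exact h2 i j k hi hc hk
    · intro h
      exact ⟨fun i j k hi hc => (h i j k hc).1 hi, fun i j k hi hc hk => hi ((h i j k hc).2 hk)⟩
  simp only [IsIrreducible, e, not_exists, not_and]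
  refine forall_congr' fun s => ?_
  rw [← Set.not_nonempty_iff_eq_empty]
  tauto

end Characterizations

/-! ### The diagonal Nikolayevsky derivation -/

section Nikolayevsky

variable {L : Type*} [LieRing L] [LieAlgebra ℝ L] {n : ℕ} {b : Basis (Fin n) ℝ L}

lemma repr_diagOp (v : Fin n → ℝ) (x : L) (i : Fin n) :
    b.repr (diagOp b v x) i = v i * b.repr x i := by
  rw [repr_map_eq_sum, Finset.sum_eq_single i]
  · simp [diagOp_basis, mul_comm]
  · intro j _ hj
    simp [diagOp_basis, hj]
  · simp

lemma isSemisimple_diagOp (v : Fin n → ℝ) : (diagOp b v).IsSemisimple := by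
  classical
  set p : Polynomial ℝ := ∏ a ∈ Finset.univ.image v, (Polynomial.X - Polynomial.C a) with hp
  have hsq : Squarefree p := by
    refine Polynomial.Separable.squarefree ?_
    exact Polynomial.separable_prod_X_sub_C_iff'.2 fun x _ y _ h => h
  refine Module.End.isSemisimple_of_squarefree_aeval_eq_zero hsq ?_
  refine b.ext fun i => ?_
  have hi : v i ∈ Finset.univ.image v := Finset.mem_image_of_mem _ (Finset.mem_univ i)
  rw [hp, ← Finset.prod_erase_mul _ _ hi, map_mul, Module.End.mul_apply]
  simp [diagOp_basis]

lemma trace_eq_sum_repr (f : L →ₗ[ℝ] L) :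
    LinearMap.trace ℝ L f = ∑ i, b.repr (f (b i)) i := by
  rw [LinearMap.trace_eq_matrix_trace ℝ b, Matrix.trace]
  exact Finset.sum_congr rfl fun i _ => by rw [Matrix.diag_apply, LinearMap.toMatrix_apply]

lemma diagOp_lie (v : Fin n → ℝ) (hv : ∀ i j k, sc b i j k ≠ 0 → v i + v j = v k) (x y : L) :
    diagOp b v ⁅x, y⁆ = ⁅x, diagOp b v y⁆ - ⁅y, diagOp b v x⁆ := by
  rw [← lie_skew y, sub_neg_eq_add]
  refine b.repr.injective (Finsupp.ext fun k => ?_)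
  rw [repr_diagOp, map_add, Finsupp.add_apply, repr_lie_eq_sum, repr_lie_eq_sum, repr_lie_eq_sum,
    Finset.mul_sum, ← Finset.sum_add_distrib]
  refine Finset.sum_congr rfl fun j _ => ?_
  rw [Finset.mul_sum, ← Finset.sum_add_distrib]
  refine Finset.sum_congr rfl fun i _ => ?_
  rw [repr_diagOp, repr_diagOp]
  by_cases hc : sc b i j k = 0
  · simp [hc]
  · rw [← hv i j k hc]
    ring

/-- The diagonal derivation with the given eigenvalues. -/
noncomputable def diagDerivation (v : Fin n → ℝ)
    (hv : ∀ i j k, sc b i j k ≠ 0 → v i + v j = v k) : LieDerivation ℝ L L where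
  toLinearMap := diagOp b v
  leibniz' := diagOp_lie v hv

lemma repr_derivation_diag (hb : NiceTriangular (sc b)) (X : LieDerivation ℝ L L)
    (i j k : Fin n) (hc : sc b i j k ≠ 0) :
    b.repr (X (b i)) i + b.repr (X (b j)) j = b.repr (X (b k)) k := by
  have h := congrArg (fun x => b.repr x k) (X.apply_lie_eq_sub (b i) (b j))
  have hij : ⁅b i, b j⁆ = sc b i j k • b k := by
    rw [lie_basis, Finset.sum_eq_single k]
    · intro k' _ hk'
      by_cases h0 : sc b i j k' = 0
      · simp [h0]
      · exact absurd (hb.tgt_unique _ _ _ _ h0 hc) hk'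
    · simp
  have aux : ∀ p q : Fin n, sc b p q k ≠ 0 → ∀ x : L,
      b.repr ⁅b p, x⁆ k = b.repr x q * sc b p q k := by
    intro p q hpq x
    rw [repr_lie_basis_left, Finset.sum_eq_single q]
    · intro q' _ hq'
      by_cases h0 : sc b p q' k = 0
      · simp [h0]
      · exact absurd (hb.src_unique _ _ _ _ h0 hpq) hq'
    · simp
  have hc' : sc b j i k ≠ 0 := by rw [sc_skew]; exact neg_ne_zero.2 hc
  simp only [hij, map_smul, map_sub, Finsupp.smul_apply, Finsupp.sub_apply, smul_eq_mul,
    aux i j hc, aux j i hc', sc_skew b i j k] at h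
  have : sc b i j k * (b.repr (X (b i)) i + b.repr (X (b j)) j - b.repr (X (b k)) k) = 0 := by
    linear_combination -h
  rcases mul_eq_zero.1 this with h0 | h0
  · exact absurd h0 hc
  · linarith

/-- A diagonal derivation `v` such that `1 - v` is a combination of the incidence vectors of the
arrows is the Nikolayevsky derivation. -/
lemma isDiagonalNikolayevsky_of_sum (hb : NiceTriangular (sc b)) {v : Fin n → ℝ}
    (hv : ∀ i j k, sc b i j k ≠ 0 → v i + v j = v k) (x : Fin n × Fin n × Fin n → ℝ)
    (hx : ∀ h, ∑ a ∈ arrows (sc b), x a * root a h = 1 - v h) :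
    IsDiagonalNikolayevsky b v := by
  refine ⟨diagDerivation v hv, rfl, isSemisimple_diagOp v, fun X => ?_⟩
  change LinearMap.trace ℝ L (diagOp b v ∘ₗ (X : L →ₗ[ℝ] L)) = _
  rw [trace_eq_sum_repr (b := b), trace_eq_sum_repr (b := b)]
  set d : Fin n → ℝ := fun i => b.repr (X (b i)) i with hd
  have h1 : ∀ i, b.repr ((diagOp b v ∘ₗ (X : L →ₗ[ℝ] L)) (b i)) i = v i * d i := by
    intro i
    rw [LinearMap.comp_apply, repr_diagOp]
    rfl
  have h2 : ∀ i, b.repr ((X : L →ₗ[ℝ] L) (b i)) i = d i := fun i => rfl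
  simp only [h1, h2]
  have h3 : ∑ i, (1 - v i) * d i = 0 := by
    simp only [← hx, Finset.sum_mul]
    rw [Finset.sum_comm]
    refine Finset.sum_eq_zero fun a ha => ?_
    have := repr_derivation_diag hb X _ _ _ (mem_arrows.1 ha).2
    have hr : ∑ h, root a h * d h = d a.1 + d a.2.1 - d a.2.2 := by
      simp [root, sub_mul, add_mul, Finset.sum_sub_distrib, Finset.sum_add_distrib]
    simp only [mul_assoc, ← Finset.mul_sum, hr]
    rw [show d a.1 + d a.2.1 = d a.2.2 from this]
    ring
  simp only [sub_mul, one_mul, Finset.sum_sub_distrib] at h3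
  linarith

lemma IsDiagonalNikolayevsky.unique {v w : Fin n → ℝ} (hv : IsDiagonalNikolayevsky b v)
    (hw : IsDiagonalNikolayevsky b w) : v = w := by
  obtain ⟨N, hN, -, h1⟩ := hv
  obtain ⟨N', hN', -, h2⟩ := hw
  have ev : ∀ u u' : Fin n → ℝ, LinearMap.trace ℝ L (diagOp b u ∘ₗ diagOp b u')
      = ∑ i, u i * u' i := by
    intro u u'
    rw [trace_eq_sum_repr (b := b)]
    exact Finset.sum_congr rfl fun i _ => by simp [diagOp_basis, mul_comm]
  have a1 := h1 N
  have a2 := h1 N'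
  have a3 := h2 N
  have a4 := h2 N'
  rw [hN, ev] at a1
  rw [hN, hN', ev] at a2
  rw [hN, hN', ev] at a3
  rw [hN', ev] at a4
  have : ∑ i, (v i - w i) ^ 2 = 0 := by
    have : ∑ i, (v i - w i) ^ 2
        = ∑ i, v i * v i - ∑ i, v i * w i - ∑ i, w i * v i + ∑ i, w i * w i := by
      rw [← Finset.sum_sub_distrib, ← Finset.sum_sub_distrib, ← Finset.sum_add_distrib]
      exact Finset.sum_congr rfl fun i _ => by ring
    linarith
  rw [Finset.sum_eq_zero_iff_of_nonneg fun i _ => sq_nonneg _] at this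
  funext i
  have := this i (Finset.mem_univ i)
  have := pow_eq_zero_iff two_ne_zero |>.1 this
  linarith

end Nikolayevsky

/-! ### Relabelling and rescaling of the basis -/

section Equivalence

variable {L : Type*} [LieRing L] [LieAlgebra ℝ L] {m n : ℕ} {b : Basis (Fin n) ℝ L}
  {b' : Basis (Fin m) ℝ L} {e : Fin m ≃ Fin n} {c : Fin m → ℝ}

lemma repr_of_rescale (hc : ∀ i, c i ≠ 0) (h : ∀ i, b' i = c i • b (e i)) (x : L) (i : Fin m) :
    b'.repr x i = b.repr x (e i) / c i := by
  have : b.repr x (e i) = ∑ j, b'.repr x j * b.repr (b' j) (e i) := by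
    conv_lhs => rw [← b'.sum_repr x]
    simp only [map_sum, map_smul, Finsupp.coe_finsetSum, Finset.sum_apply, Finsupp.smul_apply,
      smul_eq_mul]
  rw [this, Finset.sum_eq_single i]
  · rw [h]
    simp [hc i]
  · intro j _ hj
    simp [h, hj]
  · simp

lemma sc_of_rescale (hc : ∀ i, c i ≠ 0) (h : ∀ i, b' i = c i • b (e i)) (i j k : Fin m) :
    sc b' i j k = c i * c j / c k * sc b (e i) (e j) (e k) := by
  rw [sc, repr_of_rescale hc h, h, h, smul_lie, lie_smul, smul_smul, map_smul, Finsupp.smul_apply,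
    sc, smul_eq_mul]
  ring

lemma sc_ne_zero_of_rescale (hc : ∀ i, c i ≠ 0) (h : ∀ i, b' i = c i • b (e i)) (i j k : Fin m) :
    sc b' i j k ≠ 0 ↔ sc b (e i) (e j) (e k) ≠ 0 := by
  rw [sc_of_rescale hc h]
  simp [hc]

lemma isNice_of_rescale (hc : ∀ i, c i ≠ 0) (h : ∀ i, b' i = c i • b (e i)) :
    IsNice b' ↔ IsNice b := by
  simp only [isNice_iff, sc_ne_zero_of_rescale hc h]
  refine and_congr ?_ ?_
  · constructor
    · intro H i j k k' h1 h2
      simpa using H (e.symm i) (e.symm j) (e.symm k) (e.symm k') (by simpa using h1)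
        (by simpa using h2)
    · exact fun H i j k k' h1 h2 => e.injective (H _ _ _ _ h1 h2)
  · constructor
    · intro H i j k k' h1 h2
      simpa using H (e.symm i) (e.symm j) (e.symm k) (e.symm k') (by simpa using h1)
        (by simpa using h2)
    · exact fun H i j k k' h1 h2 => e.injective (H _ _ _ _ h1 h2)

lemma isIrreducible_of_rescale (hc : ∀ i, c i ≠ 0) (h : ∀ i, b' i = c i • b (e i)) :
    IsIrreducible b' ↔ IsIrreducible b := by
  simp only [isIrreducible_iff, sc_ne_zero_of_rescale hc h]
  constructor
  · intro H s hs hne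
    have := H (e ⁻¹' s) (fun i j k hijk => hs _ _ _ hijk)
      (by obtain ⟨x, hx⟩ := hne; exact ⟨e.symm x, by simpa using hx⟩)
    ext x
    have hx := Set.ext_iff.1 this (e.symm x)
    simpa using hx
  · intro H s hs hne
    have := H (e.symm ⁻¹' s) (fun i j k hijk =>
      hs (e.symm i) (e.symm j) (e.symm k) (by simpa using hijk))
      (by obtain ⟨x, hx⟩ := hne; exact ⟨e x, by simpa using hx⟩)
    ext x
    have hx := Set.ext_iff.1 this (e x)
    simpa using hx

lemma diagOp_of_rescale (h : ∀ i, b' i = c i • b (e i)) (v : Fin m → ℝ) :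
    diagOp b' v = diagOp b (fun i => v (e.symm i)) := by
  refine b'.ext fun i => ?_
  rw [diagOp_basis, h, map_smul, diagOp_basis, smul_comm]
  simp

lemma diagMetric_of_rescale (hc : ∀ i, c i ≠ 0) (h : ∀ i, b' i = c i • b (e i)) (g : Fin n → ℝ) :
    diagMetric b' (fun i => g (e i) * c i ^ 2) = diagMetric b g := by
  refine LinearMap.ext fun x => LinearMap.ext fun y => ?_
  rw [diagMetric_apply, diagMetric_apply]
  refine Fintype.sum_equiv e _ _ fun i => ?_
  rw [repr_of_rescale hc h, repr_of_rescale hc h]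
  have := hc i
  field_simp

lemma isDiagonalNikolayevsky_of_rescale (h : ∀ i, b' i = c i • b (e i)) (v : Fin m → ℝ) :
    IsDiagonalNikolayevsky b' v ↔ IsDiagonalNikolayevsky b (fun i => v (e.symm i)) := by
  simp only [IsDiagonalNikolayevsky, diagOp_of_rescale h]

lemma isNormalizedNilsoliton_of_rescale (hc : ∀ i, c i ≠ 0) (h : ∀ i, b' i = c i • b (e i))
    (g : Fin n → ℝ) :
    IsNormalizedNilsoliton b' (fun i => g (e i) * c i ^ 2) ↔ IsNormalizedNilsoliton b g := by
  simp only [IsNormalizedNilsoliton, diagMetric_of_rescale hc h,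
    isDiagonalNikolayevsky_of_rescale h, diagOp_of_rescale h]
  constructor
  · rintro ⟨v, h1, h2, h3⟩
    refine ⟨fun i => v (e.symm i), h1, fun h0 => h2 ?_, h3⟩
    funext i
    simpa using congrFun h0 (e i)
  · rintro ⟨v, h1, h2, h3⟩
    refine ⟨fun i => v (e i), by simpa using h1, fun h0 => h2 ?_, by simpa using h3⟩
    funext i
    simpa using congrFun h0 (e.symm i)

lemma signatures_of_rescale (hc : ∀ i, c i ≠ 0) (h : ∀ i, b' i = c i • b (e i)) :
    signatures b = (fun s => s.map e.toEmbedding) '' signatures b' := by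
  have sgn : ∀ (g : ℝ) (i : Fin m), g * c i ^ 2 < 0 ↔ g < 0 := by
    intro g i
    have : 0 < c i ^ 2 := by have := hc i; positivity
    constructor
    · intro h1; by_contra h2; push Not at h2; exact absurd h1 (not_lt.2 (by positivity))
    · intro h1; exact mul_neg_of_neg_of_pos h1 this
  ext s
  simp only [Set.mem_image]
  constructor
  · rintro ⟨g, h0, hs, hg⟩
    refine ⟨s.map e.symm.toEmbedding, ⟨fun i => g (e i) * c i ^ 2, ?_, ?_,
      (isNormalizedNilsoliton_of_rescale hc h g).2 hg⟩, ?_⟩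
    · intro i
      exact mul_ne_zero (h0 _) (pow_ne_zero _ (hc i))
    · intro i
      rw [sgn, ← hs]
      simp
    · ext i
      simp
  · rintro ⟨s', ⟨g', h0, hs, hg⟩, rfl⟩
    have hgg : (fun i => (fun k => g' (e.symm k) / c (e.symm k) ^ 2) (e i) * c i ^ 2) = g' := by
      funext i
      have := hc i
      simp only [Equiv.symm_apply_apply]
      field_simp
    refine ⟨fun k => g' (e.symm k) / c (e.symm k) ^ 2, ?_, ?_, ?_⟩
    · intro i
      exact div_ne_zero (h0 _) (pow_ne_zero _ (hc _))
    · intro i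
      rw [← sgn _ (e.symm i), div_mul_cancel₀ _ (pow_ne_zero _ (hc _)), ← hs]
      simp
    · rw [← isNormalizedNilsoliton_of_rescale hc h, hgg]
      exact hg

end Equivalence

/-! ### Monomial equations attached to a set of arrows -/

section Monomial

variable {n : ℕ}

/-- Integer vectors `P a` that are, up to the common factor `d`, dual to the incidence vectors of
the arrows in `S`. -/
structure IsDual (S : Finset (Fin n × Fin n × Fin n))
    (P : Fin n × Fin n × Fin n → Fin n → ℤ) (d : ℤ) : Prop where
  ne_zero : d ≠ 0
  pairing : ∀ a ∈ S, ∀ a' ∈ S,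
    P a a'.1 + P a a'.2.1 - P a a'.2.2 = if a = a' then d else 0

variable {S : Finset (Fin n × Fin n × Fin n)} {P : Fin n × Fin n × Fin n → Fin n → ℤ} {d : ℤ}

lemma sum_root_mul (a : Fin n × Fin n × Fin n) (f : Fin n → ℝ) :
    ∑ h, root a h * f h = f a.1 + f a.2.1 - f a.2.2 := by
  simp [root, sub_mul, add_mul, Finset.sum_sub_distrib, Finset.sum_add_distrib]

lemma sum_mul_root_pairing (z : Fin n × Fin n × Fin n → ℝ)
    (hz : ∀ h, ∑ a ∈ S, z a * root a h = 0) (p : Fin n → ℤ) :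
    ∑ a ∈ S, z a * ((p a.1 + p a.2.1 - p a.2.2 : ℤ) : ℝ) = 0 := by
  have : ∑ h, (∑ a ∈ S, z a * root a h) * (p h : ℝ) = 0 := by simp [hz]
  simp only [Finset.sum_mul] at this
  rw [Finset.sum_comm] at this
  rw [← this]
  refine Finset.sum_congr rfl fun a _ => ?_
  have := sum_root_mul a (fun h => (p h : ℝ))
  simp only [mul_assoc, ← Finset.mul_sum, this]
  push_cast
  rfl

lemma IsDual.eq_zero (hP : IsDual S P d) (z : Fin n × Fin n × Fin n → ℝ)
    (hz : ∀ h, ∑ a ∈ S, z a * root a h = 0) : ∀ a ∈ S, z a = 0 := by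
  intro a ha
  have := sum_mul_root_pairing z hz (P a)
  rw [Finset.sum_eq_single a] at this
  · rw [hP.pairing a ha a ha, if_pos rfl] at this
    exact (mul_eq_zero.1 this).resolve_right (by exact_mod_cast hP.ne_zero)
  · intro a' ha' hne
    rw [hP.pairing a ha a' ha', if_neg hne.symm]
    simp
  · exact fun h => absurd ha h

lemma IsDual.exists_pos (hP : IsDual S P d) (y : Fin n × Fin n × Fin n → ℝ)
    (hy : ∀ a ∈ S, 0 < y a) :
    ∃ t : Fin n → ℝ, (∀ h, 0 < t h) ∧ ∀ a ∈ S, t a.1 * t a.2.1 / t a.2.2 = y a := by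
  refine ⟨fun h => Real.exp (∑ a ∈ S, P a h * (Real.log (y a) / d)), fun h => Real.exp_pos _, ?_⟩
  intro a' ha'
  rw [← Real.exp_add, ← Real.exp_sub, ← Finset.sum_add_distrib, ← Finset.sum_sub_distrib]
  have hd : (d : ℝ) ≠ 0 := by exact_mod_cast hP.ne_zero
  have e : ∀ a ∈ S, P a a'.1 * (Real.log (y a) / d) + P a a'.2.1 * (Real.log (y a) / d)
      - P a a'.2.2 * (Real.log (y a) / d) = if a = a' then Real.log (y a) else 0 := by
    intro a ha
    have h1 := hP.pairing a ha a' ha'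
    have h2 : (P a a'.1 : ℝ) + P a a'.2.1 - P a a'.2.2 = if a = a' then (d : ℝ) else 0 := by
      exact_mod_cast h1
    rw [← add_mul, ← sub_mul, h2]
    split_ifs
    · field_simp
    · simp
  rw [Finset.sum_congr rfl e, Finset.sum_ite_eq', if_pos ha', Real.exp_log (hy _ ha')]

lemma IsDual.exists_ne_zero (hP : IsDual S P 1) (y : Fin n × Fin n × Fin n → ℝ)
    (hy : ∀ a ∈ S, y a ≠ 0) :
    ∃ t : Fin n → ℝ, (∀ h, t h ≠ 0) ∧ ∀ a ∈ S, t a.1 * t a.2.1 / t a.2.2 = y a := by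
  refine ⟨fun h => ∏ a ∈ S, y a ^ P a h, fun h => ?_, ?_⟩
  · exact Finset.prod_ne_zero_iff.2 fun a ha => zpow_ne_zero _ (hy a ha)
  intro a' ha'
  rw [← Finset.prod_mul_distrib, ← Finset.prod_div_distrib]
  have e : ∀ a ∈ S, y a ^ P a a'.1 * y a ^ P a a'.2.1 / y a ^ P a a'.2.2
      = if a = a' then y a else 1 := by
    intro a ha
    rw [← zpow_add₀ (hy a ha), ← zpow_sub₀ (hy a ha), hP.pairing a ha a' ha']
    split_ifs <;> simp
  rw [Finset.prod_congr rfl e, Finset.prod_ite_eq', if_pos ha']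

/-- The quantity `g_k / (g_i g_j)` attached to an arrow `{i, j} → k`. -/
noncomputable def arrowRatio (g : Fin n → ℝ) (a : Fin n × Fin n × Fin n) : ℝ :=
  g a.2.2 / (g a.1 * g a.2.1)

/-- The system `∑ x_a root_a = ∑ lam_a root_a`, where `x_a = g_k / (g_i g_j)`, has solutions, all of
which satisfy `x = lam`. -/
structure IsRigid (A : Finset (Fin n × Fin n × Fin n)) (lam : Fin n × Fin n × Fin n → ℝ) :
    Prop where
  unique : ∀ g : Fin n → ℝ, (∀ i, g i ≠ 0) →
    (∀ h, ∑ a ∈ A, arrowRatio g a * root a h = ∑ a ∈ A, lam a * root a h) →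
    ∀ a ∈ A, arrowRatio g a = lam a
  exists_pos : ∃ g : Fin n → ℝ, (∀ i, 0 < g i) ∧ ∀ a ∈ A, arrowRatio g a = lam a

lemma arrowRatio_eq_inv (g : Fin n → ℝ) (a : Fin n × Fin n × Fin n) :
    arrowRatio g a = (g a.1 * g a.2.1 / g a.2.2)⁻¹ := by
  rw [arrowRatio, inv_div]

lemma IsDual.exists_arrowRatio (hP : IsDual S P d) (y : Fin n × Fin n × Fin n → ℝ)
    (hy : ∀ a ∈ S, 0 < y a) :
    ∃ g : Fin n → ℝ, (∀ h, 0 < g h) ∧ ∀ a ∈ S, arrowRatio g a = y a := by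
  obtain ⟨g, hg, h⟩ := hP.exists_pos (fun a => (y a)⁻¹) fun a ha => inv_pos.2 (hy a ha)
  exact ⟨g, hg, fun a ha => by rw [arrowRatio_eq_inv, h a ha, inv_inv]⟩

lemma IsDual.isRigid (hP : IsDual S P d) {lam : Fin n × Fin n × Fin n → ℝ}
    (hlam : ∀ a ∈ S, 0 < lam a) : IsRigid S lam where
  unique g _ h a ha := by
    have := hP.eq_zero (fun a => arrowRatio g a - lam a)
      (fun k => by simp only [sub_mul, Finset.sum_sub_distrib, h k, sub_self]) a ha
    simpa [sub_eq_zero] using this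
  exists_pos := hP.exists_arrowRatio lam hlam

/-- Adding an arrow `a₀` to a set of arrows with a dual system, by means of a vector that is
orthogonal to the latter but not to `a₀`. -/
lemma IsDual.insert_of_orthogonal {a₀ : Fin n × Fin n × Fin n} (ha₀ : a₀ ∉ S) (hP : IsDual S P d)
    {p : Fin n → ℤ} {d₀ : ℤ} (hd₀ : d₀ ≠ 0) (hp : ∀ a ∈ S, p a.1 + p a.2.1 - p a.2.2 = 0)
    (hp₀ : p a₀.1 + p a₀.2.1 - p a₀.2.2 = d₀) :
    IsDual (insert a₀ S)
      (fun a h => if a = a₀ then d * p h else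
        d₀ * P a h - (P a a₀.1 + P a a₀.2.1 - P a a₀.2.2) * p h) (d * d₀) where
  ne_zero := mul_ne_zero hP.ne_zero hd₀
  pairing := by
    intro a ha a' ha'
    have hne : ∀ x ∈ S, x ≠ a₀ := fun x hx h => ha₀ (h ▸ hx)
    rcases Finset.mem_insert.1 ha with rfl | haS
    · simp only [if_true]
      rcases Finset.mem_insert.1 ha' with rfl | ha'
      · rw [if_pos rfl, ← hp₀]; ring
      · rw [if_neg (hne _ ha').symm]
        linear_combination d * hp a' ha'
    · simp only [if_neg (hne a haS)]
      rcases Finset.mem_insert.1 ha' with rfl | ha'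
      · rw [if_neg (hne a haS)]
        linear_combination -(P a a'.1 + P a a'.2.1 - P a a'.2.2) * hp₀
      · have h1 := hP.pairing a haS a' ha'
        have h2 := hp a' ha'
        split_ifs with h
        · rw [if_pos h] at h1
          linear_combination d₀ * h1 - (P a a₀.1 + P a a₀.2.1 - P a a₀.2.2) * h2
        · rw [if_neg h] at h1
          linear_combination d₀ * h1 - (P a a₀.1 + P a a₀.2.1 - P a a₀.2.2) * h2

/-- When only a multiple of `a₀` can be completed to a dual system, the monomial equation for `a₀`
can be solved up to sign. -/
lemma IsDual.exists_up_to_sign {a₀ : Fin n × Fin n × Fin n} {P' : Fin n × Fin n × Fin n → Fin n → ℤ}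
    (ha₀ : a₀ ∉ S) (hP : IsDual S P 1) (hP' : IsDual (insert a₀ S) P' d)
    (y : Fin n × Fin n × Fin n → ℝ) (hy : ∀ a ∈ insert a₀ S, y a ≠ 0) :
    ∃ t : Fin n → ℝ, (∀ h, t h ≠ 0) ∧ (∀ a ∈ S, t a.1 * t a.2.1 / t a.2.2 = y a) ∧
      (t a₀.1 * t a₀.2.1 / t a₀.2.2 = y a₀ ∨ t a₀.1 * t a₀.2.1 / t a₀.2.2 = -y a₀) := by
  obtain ⟨t, ht, h1⟩ := hP.exists_ne_zero y fun a ha => hy a (Finset.mem_insert_of_mem ha)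
  set r := t a₀.1 * t a₀.2.1 / t a₀.2.2 with hr
  have hr0 : r ≠ 0 := div_ne_zero (mul_ne_zero (ht _) (ht _)) (ht _)
  have hy0 : y a₀ ≠ 0 := hy _ (Finset.mem_insert_self _ _)
  obtain ⟨s, hs, h2⟩ := hP'.exists_pos (fun a => if a = a₀ then |y a₀ / r| else 1) (by
    intro a _
    split_ifs
    · exact abs_pos.2 (div_ne_zero hy0 hr0)
    · exact one_pos)
  refine ⟨fun h => t h * s h, fun h => mul_ne_zero (ht h) (hs h).ne', fun a ha => ?_, ?_⟩
  · rw [mul_mul_mul_comm, mul_div_mul_comm, h1 a ha, h2 a (Finset.mem_insert_of_mem ha),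
      if_neg (fun h : a = a₀ => ha₀ (h ▸ ha)), mul_one]
  · simp only [mul_mul_mul_comm, mul_div_mul_comm, h2 a₀ (Finset.mem_insert_self _ _), if_true,
      ← hr]
    rcases abs_choice (y a₀ / r) with h | h
    · left; rw [h]; field_simp
    · right; rw [h]; field_simp

/-- The arrow `{i, j} → k`, with the sources in increasing order. -/
def mkArrow {ι : Type*} [LT ι] [DecidableLT ι] (i j k : ι) : ι × ι × ι :=
  if i < j then (i, j, k) else (j, i, k)

lemma arrowRatio_mkArrow (g : Fin n → ℝ) (i j k : Fin n) :
    arrowRatio g (mkArrow i j k) = g k / (g i * g j) := by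
  rw [mkArrow]
  split_ifs
  · rfl
  · rw [arrowRatio, mul_comm]

lemma root_mkArrow (i j k h : Fin n) : root (mkArrow i j k) h = root (i, j, k) h := by
  rw [mkArrow]
  split_ifs
  · rfl
  · simp only [root]; ring

/-- Four arrows appearing in a Jacobi identity with two nonzero terms
`[[e_x, e_y], e_z] + [[e_y, e_z], e_x] = 0`, the intermediate brackets being multiples of `e_w`
and `e_w'`, and the double brackets multiples of `e_u`. -/
structure JacobiSquare (n : ℕ) where
  x : Fin n
  y : Fin n
  z : Fin n
  w : Fin n
  w' : Fin n
  u : Fin n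

namespace JacobiSquare

variable (q : JacobiSquare n)

/-- `{x, y} → w`. -/
def a₀ : Fin n × Fin n × Fin n := mkArrow q.x q.y q.w

/-- `{w, z} → u`. -/
def a₁ : Fin n × Fin n × Fin n := mkArrow q.w q.z q.u

/-- `{y, z} → w'`. -/
def a₂ : Fin n × Fin n × Fin n := mkArrow q.y q.z q.w'

/-- `{w', x} → u`. -/
def a₃ : Fin n × Fin n × Fin n := mkArrow q.w' q.x q.u

/-- The arrows of the square are distinct, and all but the first lie in `S`. -/
structure Within (S : Finset (Fin n × Fin n × Fin n)) : Prop where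
  not_mem : q.a₀ ∉ S
  mem₁ : q.a₁ ∈ S
  mem₂ : q.a₂ ∈ S
  mem₃ : q.a₃ ∈ S
  ne₁₂ : q.a₁ ≠ q.a₂
  ne₁₃ : q.a₁ ≠ q.a₃
  ne₂₃ : q.a₂ ≠ q.a₃

variable {q}

lemma arrowRatio_mul {g : Fin n → ℝ} (hg : ∀ i, g i ≠ 0) :
    arrowRatio g q.a₀ * arrowRatio g q.a₁ = arrowRatio g q.a₂ * arrowRatio g q.a₃ := by
  simp only [a₀, a₁, a₂, a₃, arrowRatio_mkArrow]
  have := hg q.x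
  have := hg q.y
  have := hg q.z
  have := hg q.w
  have := hg q.w'
  field_simp

lemma root_add (h : Fin n) : root q.a₀ h + root q.a₁ h = root q.a₂ h + root q.a₃ h := by
  simp only [a₀, a₁, a₂, a₃, root_mkArrow]
  simp only [root]
  ring

lemma isRigid (hq : q.Within S) (hP : IsDual S P d) {lam : Fin n × Fin n × Fin n → ℝ}
    (hpos : ∀ a ∈ insert q.a₀ S, 0 < lam a)
    (hlam : lam q.a₀ * lam q.a₁ = lam q.a₂ * lam q.a₃) :
    IsRigid (insert q.a₀ S) lam where
  unique g hg h := by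
    set z : Fin n × Fin n × Fin n → ℝ := fun a => arrowRatio g a - lam a with hz
    have hsum : ∀ k, z q.a₀ * root q.a₀ k + ∑ a ∈ S, z a * root a k = 0 := by
      intro k
      have := h k
      rw [Finset.sum_insert hq.not_mem, Finset.sum_insert hq.not_mem] at this
      simp only [hz, sub_mul, Finset.sum_sub_distrib]
      linarith
    set z' : Fin n × Fin n × Fin n → ℝ := fun a => z a + z q.a₀ *
      ((if a = q.a₂ then 1 else 0) + (if a = q.a₃ then 1 else 0) - (if a = q.a₁ then 1 else 0))
      with hz'
    have hz0 : ∀ a ∈ S, z' a = 0 := by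
      refine hP.eq_zero z' fun k => ?_
      have e : ∀ c ∈ S, ∑ a ∈ S, (if a = c then (1 : ℝ) else 0) * root a k = root c k := by
        intro c hc
        simp [hc]
      have : ∑ a ∈ S, z' a * root a k = ∑ a ∈ S, z a * root a k
          + z q.a₀ * (root q.a₂ k + root q.a₃ k - root q.a₁ k) := by
        rw [← e _ hq.mem₁, ← e _ hq.mem₂, ← e _ hq.mem₃, ← Finset.sum_add_distrib,
          ← Finset.sum_sub_distrib, Finset.mul_sum, ← Finset.sum_add_distrib]
        exact Finset.sum_congr rfl fun a _ => by simp only [hz']; ring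
      rw [this]
      linear_combination hsum k - z q.a₀ * root_add (q := q) k
    have r1 := hz0 _ hq.mem₁
    have r2 := hz0 _ hq.mem₂
    have r3 := hz0 _ hq.mem₃
    simp only [hz', if_true, if_neg hq.ne₁₂, if_neg hq.ne₁₃, if_neg hq.ne₁₂.symm,
      if_neg hq.ne₁₃.symm, if_neg hq.ne₂₃, if_neg hq.ne₂₃.symm] at r1 r2 r3
    have hm := arrowRatio_mul (q := q) hg
    have x0 : arrowRatio g q.a₀ = lam q.a₀ + z q.a₀ := by simp only [hz]; ring
    have x1 : arrowRatio g q.a₁ = lam q.a₁ + z q.a₀ := by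
      have : z q.a₁ = arrowRatio g q.a₁ - lam q.a₁ := rfl
      linarith
    have x2 : arrowRatio g q.a₂ = lam q.a₂ - z q.a₀ := by
      have : z q.a₂ = arrowRatio g q.a₂ - lam q.a₂ := rfl
      linarith
    have x3 : arrowRatio g q.a₃ = lam q.a₃ - z q.a₀ := by
      have : z q.a₃ = arrowRatio g q.a₃ - lam q.a₃ := rfl
      linarith
    rw [x0, x1, x2, x3] at hm
    have hprod : z q.a₀ * (lam q.a₀ + lam q.a₁ + lam q.a₂ + lam q.a₃) = 0 := by
      linear_combination hm - hlam
    have p0 := hpos _ (Finset.mem_insert_self _ _)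
    have p1 := hpos _ (Finset.mem_insert_of_mem hq.mem₁)
    have p2 := hpos _ (Finset.mem_insert_of_mem hq.mem₂)
    have p3 := hpos _ (Finset.mem_insert_of_mem hq.mem₃)
    have hzero : z q.a₀ = 0 := (mul_eq_zero.1 hprod).resolve_right (by positivity)
    intro a ha
    have : z a = 0 := by
      rcases Finset.mem_insert.1 ha with rfl | ha
      · exact hzero
      · have := hz0 a ha
        simpa only [hz', hzero, zero_mul, add_zero] using this
    simpa [hz, sub_eq_zero] using this
  exists_pos := by
    obtain ⟨g, hg, h⟩ := hP.exists_arrowRatio lam fun a ha => hpos a (Finset.mem_insert_of_mem ha)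
    refine ⟨g, hg, fun a ha => ?_⟩
    rcases Finset.mem_insert.1 ha with rfl | ha
    · have hm := arrowRatio_mul (q := q) fun i => (hg i).ne'
      rw [h _ hq.mem₁, h _ hq.mem₂, h _ hq.mem₃, ← hlam] at hm
      exact mul_right_cancel₀ (hpos _ (Finset.mem_insert_of_mem hq.mem₁)).ne' hm
    · exact h a ha

/-- If `t` solves the monomial equations for `S`, it also solves the one for the first arrow. -/
lemma solves_first (hq : q.Within S) {t : Fin n → ℝ} (ht : ∀ i, t i ≠ 0)
    {y : Fin n × Fin n × Fin n → ℝ} (hy : ∀ a ∈ S, y a ≠ 0)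
    (hyq : y q.a₀ * y q.a₁ = y q.a₂ * y q.a₃)
    (h : ∀ a ∈ S, t a.1 * t a.2.1 / t a.2.2 = y a) :
    t q.a₀.1 * t q.a₀.2.1 / t q.a₀.2.2 = y q.a₀ := by
  have hm := arrowRatio_mul (q := q) ht
  rw [arrowRatio_eq_inv, arrowRatio_eq_inv, arrowRatio_eq_inv, arrowRatio_eq_inv,
    h _ hq.mem₁, h _ hq.mem₂, h _ hq.mem₃, ← mul_inv, ← mul_inv, inv_inj, ← hyq] at hm
  exact mul_right_cancel₀ (hy _ hq.mem₁) hm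

end JacobiSquare

end Monomial

/-! ### Signatures -/

section Signatures

variable {L : Type*} [LieRing L] [LieAlgebra ℝ L] {n : ℕ} {b : Basis (Fin n) ℝ L}

lemma arrowRatio_pos_iff {g : Fin n → ℝ} (hg : ∀ i, g i ≠ 0) (a : Fin n × Fin n × Fin n) :
    0 < arrowRatio g a ↔ (g a.2.2 < 0 ↔ (g a.1 < 0 ↔ ¬ g a.2.1 < 0)) := by
  have h : ∀ i, (g i < 0 ∧ ¬ 0 < g i) ∨ (¬ g i < 0 ∧ 0 < g i) := by
    intro i
    rcases lt_or_gt_of_ne (hg i) with h | h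
    · exact Or.inl ⟨h, h.not_gt⟩
    · exact Or.inr ⟨h.not_gt, h⟩
  rw [arrowRatio, div_pos_iff, mul_pos_iff, mul_neg_iff]
  have h1 := h a.1
  have h2 := h a.2.1
  have h3 := h a.2.2
  tauto

/-- The signatures of the normalized nilsoliton metrics, when the defining system is rigid. -/
theorem signatures_eq_of_isRigid (hb : NiceTriangular (sc b))
    (hsq : ∀ i j k, sc b i j k ≠ 0 → sc b i j k ^ 2 = 1) {v : Fin n → ℝ} (hv : v ≠ 0)
    (hN : IsDiagonalNikolayevsky b v) {lam : Fin n × Fin n × Fin n → ℝ}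
    (hlam : ∀ a ∈ arrows (sc b), 0 < lam a)
    (hsum : ∀ h, ∑ a ∈ arrows (sc b), lam a * root a h = 1 - v h)
    (hr : IsRigid (arrows (sc b)) lam) :
    signatures b = {s | ∀ a ∈ arrows (sc b), (a.2.2 ∈ s ↔ (a.1 ∈ s ↔ a.2.1 ∉ s))} := by
  have sys : ∀ g : Fin n → ℝ, (∀ i, g i ≠ 0) →
      (IsRicciOperator (diagMetric b g)
        (-(1 / 2 : ℝ) • (1 : Module.End ℝ L) + (1 / 2 : ℝ) • diagOp b v) ↔
      ∀ h, ∑ a ∈ arrows (sc b), arrowRatio g a * root a h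
        = ∑ a ∈ arrows (sc b), lam a * root a h) := by
    intro g hg
    rw [isRicciOperator_diag_iff hb hg]
    refine forall_congr' fun h => ?_
    rw [hsum]
    refine Eq.congr (Finset.sum_congr rfl fun a ha => ?_) rfl
    rw [hsq _ _ _ (mem_arrows.1 ha).2, one_mul, arrowRatio]
  ext s
  constructor
  · rintro ⟨g, hg, hs, v', hv', -, hric⟩ a ha
    obtain rfl := hv'.unique hN
    have := hr.unique g hg ((sys g hg).1 hric) a ha
    have hpos := hlam a ha
    rw [← this, arrowRatio_pos_iff hg] at hpos
    simpa only [hs] using hpos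
  · intro hs
    classical
    obtain ⟨g, hg, h⟩ := hr.exists_pos
    set g' : Fin n → ℝ := fun i => if i ∈ s then -g i else g i with hg'
    have hg0 : ∀ i, g' i ≠ 0 := by
      intro i
      have := (hg i).ne'
      simp only [hg']
      split_ifs <;> simpa using this
    have hneg : ∀ i, i ∈ s ↔ g' i < 0 := by
      intro i
      have := hg i
      simp only [hg']
      split_ifs with hi
      · simp [hi, this]
      · simp [hi, this.le]
    refine ⟨g', hg0, hneg, v, hN, hv, (sys g' hg0).2 fun k => ?_⟩
    refine Finset.sum_congr rfl fun a ha => ?_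
    have habs : |arrowRatio g' a| = lam a := by
      have e : ∀ i, |g' i| = g i := by
        intro i
        simp only [hg']
        split_ifs
        · rw [abs_neg, abs_of_pos (hg i)]
        · rw [abs_of_pos (hg i)]
      rw [← h a ha, arrowRatio, arrowRatio, abs_div, abs_mul, e, e, e]
    have hpos : 0 < arrowRatio g' a := by
      rw [arrowRatio_pos_iff hg0]
      simpa only [hneg] using hs a ha
    rw [← habs, abs_of_pos hpos]

end Signatures

/-! ### Certificates for the rows of the table

Indices are natural numbers starting from `0`, and the arrow `{i, j} → k` with `i < j` is written
`(i, j, k)`. -/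

/-- How the arrows of a row fail to be linearly independent modulo `2`: they do not; or there is an
arrow `a₀` with `d₀` times its dual vector integral; or there is a Jacobi identity with two nonzero
terms `[[e_x, e_y], e_z] + [[e_y, e_z], e_x] = 0`. -/
inductive Excess where
  | none
  | half (a₀ : ℕ × ℕ × ℕ) (p : List ℤ) (d₀ : ℤ)
  | jacobi (x y z w w' u : ℕ)

/-- Data about a row of the table. `lam`: the values of `g_k / (g_i g_j)` for the normalized
nilsoliton metrics. `dual`: a dual system of the incidence vectors of the arrows, except the
distinguished one. Both are ordered in the same way as the arrows. -/
structure Certificate where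
  lam : List ℚ
  dual : List (List ℤ)
  excess : Excess

/-- The certificates for the rows of the table. -/
def certificates : List Certificate :=
  [
   ⟨[1/3],
    [[1, 0, 0]], .none⟩,
   ⟨[1/3, 1/3],
    [[0, 1, 0, 0], [0, 0, 0, -1]], .none⟩,
   ⟨[1/4, 1/3, 1/4],
    [[0, 1, 0, 0, 0], [0, 1, 1, 0, 0], [0, 0, 0, 0, -1]], .none⟩,
   ⟨[3/11, 3/11, 2/11, 2/11],
    [[0, 0, -1, -1, -1], [0, -1, -1, -2, -2], [0, -1, -1, -1, -2], [0, 1, 1, 1, 1]], .none⟩,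
   ⟨[1/3, 1/4, 1/4],
    [[1, 0, 0, 1, 0], [0, 0, 0, -1, 0], [0, 0, 0, 0, -1]], .none⟩,
   ⟨[2/7, 2/7, 1/7],
    [[1, 0, -1, 0, 0], [0, 0, -1, 0, -1], [0, 0, 1, 0, 0]], .none⟩,
   ⟨[1/4, 1/4],
    [[0, 1, 0, 0, 0], [0, 0, 1, 0, 0]], .none⟩,
   ⟨[1/4, 1/4],
    [[1, 0, 0, 0, 0], [0, 0, 1, 0, 0]], .none⟩,
   ⟨[2/11, 3/11, 3/11, 2/11],
    [[0, 1, 0, 0, 0, 0], [0, 1, 1, 0, 0, 0], [0, 0, 0, 0, -1, -1], [0, 0, 0, 0, 0, -1]], .none⟩,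
   ⟨[7/34, 15/68, 9/34, 2/17, 15/68],
    [[0, 0, -1, -1, -1, -1], [0, -1, -1, -2, -2, -2], [0, -1, -1, -1, -2, -2],
      [0, -1, -1, -1, -1, -2], [0, 1, 1, 1, 1, 1]],
    .none⟩,
   ⟨[1/4, 1/3, 1/4, 1/4, 1/4],
    [[], [1, -1, 0, 0, 1, 0], [0, 1, 0, 0, -1, 0], [0, -1, 0, 0, 0, -1], [0, 1, 0, 0, 0, 0]],
    .jacobi 1 0 3 2 4 5⟩,
   ⟨[2/13, 36/143, 30/143, 2/13, 25/143, 30/143],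
    [[0, 0, -1, -1, -1, -1], [0, 0, 0, -1, -1, -1], [], [0, -1, -1, -1, -2, -2],
      [0, 1, 1, 1, 1, 1], [0, -1, -1, -1, -1, -2]],
    .jacobi 1 2 0 4 3 5⟩,
   ⟨[1/4, 4/13, 1/13, 3/13, 3/13, 1/4],
    [[], [0, -1, -1, -2, -2, -3], [0, 1, 1, 1, 1, 2], [0, -1, -2, -2, -3, -4],
      [0, 0, 1, 1, 1, 1], [0, 0, -1, -1, -1, -2]],
    .jacobi 1 0 3 2 4 5⟩,
   ⟨[1/4, 1/4, 1/4, 1/4],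
    [[0, 1, 0, 0, 1, 0], [0, 0, 0, -1, 0, -1], [0, 0, 0, 0, -1, 0], [0, 0, 0, 0, 0, -1]], .none⟩,
   ⟨[1/5, 1/4, 1/4, 1/5, 1/5],
    [[1, 0, 0, -1, 0, 0], [], [1, 0, 1, -1, 0, 0], [0, 0, 0, 1, 0, 0], [0, 0, 0, -1, 0, -1]],
    .half (0, 2, 3) [3, -1, 2, -3, 1, 0] 8⟩,
   ⟨[1/5, 1/4, 1/4, 1/5, 1/5],
    [[1, 0, 0, -1, 0, 0], [], [1, 0, 1, -1, 0, 0], [0, 0, 0, 1, 0, 0], [0, 0, 0, -1, 0, -1]],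
    .half (0, 2, 3) [3, -1, 2, -3, 1, 0] 8⟩,
   ⟨[1/5, 1/4, 1/4, 1/5, 1/5],
    [[1, 0, 0, 1, 0, 1], [], [0, 0, 0, -1, -1, -1], [0, 0, 0, 1, 0, 0], [0, 0, 0, -1, 0, -1]],
    .jacobi 0 2 1 3 4 5⟩,
   ⟨[1/5, 1/3, 1/5, 1/5],
    [[0, 1, -1, 0, 0, 0], [0, 1, -1, 1, 0, 0], [0, 0, -1, 0, 0, -1], [0, 0, 1, 0, 0, 0]], .none⟩,
   ⟨[1/4, 1/5, 1/5, 1/4, 1/5],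
    [[0, 1, 0, 0, 0, 0], [0, 1, -1, 1, 0, 0], [], [0, 0, -1, 0, 0, -1], [0, 0, 1, 0, 0, 0]],
    .jacobi 2 1 0 4 3 5⟩,
   ⟨[4/13, 3/13, 3/13, 1/13],
    [[1, 0, -1, 0, 1, 0], [0, 0, 0, 0, -1, 0], [0, 0, -1, 0, 0, -1], [0, 0, 1, 0, 0, 0]], .none⟩,
   ⟨[2/7, 1/14, 3/14, 1/14, 3/14],
    [[1, 0, -1, 0, -1, 0], [0, 0, 0, 0, -1, 0], [], [0, 0, 1, 0, 1, 0], [0, 0, -1, 0, -1, -1]],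
    .half (0, 3, 4) [2, -1, -2, 1, -3, 0] 6⟩,
   ⟨[2/7, 1/14, 3/14, 3/14, 1/14],
    [[1, 0, -1, 0, -1, 0], [0, 0, 0, 0, -1, 0], [], [0, 0, -1, 0, -1, -1], [0, 0, 1, 0, 1, 0]],
    .half (0, 3, 4) [2, -1, -2, 1, -3, 0] 6⟩,
   ⟨[2/7, 1/7, 2/7],
    [[0, 1, 0, 0, 0, 0], [0, 0, 1, 0, 0, 0], [0, 0, 0, 0, 0, -1]], .none⟩,
   ⟨[1/4, 1/4, 1/3],
    [[1, 0, -1, 0, 0, 0], [0, 0, 1, 0, 0, 0], [0, 0, 0, 0, 0, -1]], .none⟩,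
   ⟨[1/4, 1/8, 1/8, 1/4],
    [[0, 1, -1, 0, -1, 0], [0, 0, 0, 0, -1, 0], [0, 0, 1, 0, 1, 0], [0, 0, -1, 0, -1, -1]], .none⟩,
   ⟨[2/11, 3/11, 3/11, 2/11],
    [[1, 0, -2, 0, -1, 0], [0, 0, 1, 0, 0, 0], [0, 0, -1, 0, -1, -1], [0, 0, 1, 0, 1, 0]], .none⟩,
   ⟨[1/4, 1/4, 1/4, 1/4],
    [[], [1, 0, 0, 0, 0, 0], [-1, 0, 1, 0, 0, 0], [0, 1, 0, 0, 0, 0]],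
    .half (0, 1, 3) [0, 1, 0, -1, 0, 0] 2⟩,
   ⟨[1/4, 1/4, 1/4, 1/4],
    [[], [1, 0, 0, 0, 0, 0], [0, 1, 0, 0, 0, 0], [-1, 0, 1, 0, 0, 0]],
    .half (0, 1, 3) [0, 1, 0, -1, 0, 0] 2⟩,
   ⟨[1/4, 1/4, 1/4, 1/4],
    [[], [1, 0, 0, 0, 0, 0], [0, 0, 0, 1, 0, 0], [0, 1, 0, 0, 0, 0]], .jacobi 1 0 2 3 4 5⟩,
   ⟨[1/5, 1/5, 1/5],
    [[0, 0, 0, -1, 0, 0], [0, 0, 0, 0, -1, 0], [0, 0, 0, 0, 0, -1]], .none⟩,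
   ⟨[1/3, 1/4, 1/4],
    [[0, 1, 0, 0, 0, 0], [1, -1, 0, 0, 0, 0], [0, 0, 1, 0, 0, 0]], .none⟩,
   ⟨[1/5, 1/5, 1/5],
    [[0, 0, 0, 0, -1, 0], [0, 0, 1, 0, 0, 0], [0, 0, 0, 1, 0, 0]], .none⟩,
   ⟨[1/6, 1/6, 1/6, 1/6],
    [[], [0, 0, 0, 0, -1, 0], [0, 0, 1, 0, 0, 0], [1, 0, 0, 0, 0, 0]],
    .half (0, 2, 4) [1, -1, 0, 0, -1, 0] 2⟩,
   ⟨[1/6, 1/6, 1/6, 1/6],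
    [[0, 0, 0, 0, -1, 0], [], [0, 0, 1, 0, 0, 0], [1, 0, 0, 0, 0, 0]],
    .half (0, 2, 4) [1, -1, 0, 0, -1, 0] 2⟩
  ]

namespace Row

/-- The structure constants, indexed by natural numbers. -/
def const (r : Row) (i j k : ℕ) : ℤ :=
  -((r.d.getD k []).map fun t =>
    t.1 * ((if t.2.1 = i + 1 ∧ t.2.2 = j + 1 then 1 else 0) -
      (if t.2.1 = j + 1 ∧ t.2.2 = i + 1 then 1 else 0))).sum

/-- The arrows of a row. -/
def arrowList (r : Row) : List (ℕ × ℕ × ℕ) :=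
  r.d.zipIdx.flatMap fun l => l.1.map fun t => (t.2.1 - 1, t.2.2 - 1, l.2)

end Row

/-- The list of arrows is that of a nice diagram with `n` nodes. -/
def IsNiceList (n : ℕ) (l : List (ℕ × ℕ × ℕ)) : Prop :=
  ∀ a ∈ l, (a.1 < a.2.1 ∧ a.2.1 < a.2.2 ∧ a.2.2 < n) ∧ ∀ a' ∈ l,
    (a.1 = a'.1 ∧ a.2.1 = a'.2.1 ∨ a.2.2 = a'.2.2 ∧
      (a.1 = a'.1 ∨ a.1 = a'.2.1 ∨ a.2.1 = a'.1 ∨ a.2.1 = a'.2.1)) → a = a'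

instance (n : ℕ) (l : List (ℕ × ℕ × ℕ)) : Decidable (IsNiceList n l) :=
  inferInstanceAs (Decidable (∀ _ ∈ _, _))

/-- The structure constants are `±1` for the arrows in the list and vanish otherwise. -/
def IsSupport (n : ℕ) (c : ℕ → ℕ → ℕ → ℤ) (l : List (ℕ × ℕ × ℕ)) : Prop :=
  (∀ a ∈ l, c a.1 a.2.1 a.2.2 = 1 ∨ c a.1 a.2.1 a.2.2 = -1) ∧
  ∀ k ∈ List.range n, ∀ j ∈ List.range n, ∀ i ∈ List.range j, c i j k = 0 ∨ (i, j, k) ∈ l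

instance (n : ℕ) (c : ℕ → ℕ → ℕ → ℤ) (l : List (ℕ × ℕ × ℕ)) : Decidable (IsSupport n c l) :=
  inferInstanceAs (Decidable (_ ∧ _))

/-- The `u`-component of the Jacobi identity for the basis elements `i, j, k`. -/
def jacobiator (n : ℕ) (c : ℕ → ℕ → ℕ → ℤ) (i j k u : ℕ) : ℤ :=
  ∑ w ∈ Finset.range n, (c i j w * c w k u + c j k w * c w i u + c k i w * c w j u)

/-- The Jacobi identity holds for those triples that are obtained from two consecutive arrows. -/
def JacobiList (n : ℕ) (c : ℕ → ℕ → ℕ → ℤ) (l : List (ℕ × ℕ × ℕ)) : Prop :=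
  ∀ a ∈ l, ∀ a' ∈ l,
    (a'.1 = a.2.2 → jacobiator n c a.1 a.2.1 a'.2.1 a'.2.2 = 0) ∧
    (a'.2.1 = a.2.2 → jacobiator n c a.1 a.2.1 a'.1 a'.2.2 = 0)

instance (n : ℕ) (c : ℕ → ℕ → ℕ → ℤ) (l : List (ℕ × ℕ × ℕ)) : Decidable (JacobiList n c l) :=
  inferInstanceAs (Decidable (∀ _ ∈ _, _))

/-- The set of indices, encoded in binary, is a union of connected components. -/
def IsClosedSet (l : List (ℕ × ℕ × ℕ)) (m : ℕ) : Prop :=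
  ∀ a ∈ l, m.testBit a.1 = m.testBit a.2.2 ∧ m.testBit a.2.1 = m.testBit a.2.2

instance (l : List (ℕ × ℕ × ℕ)) (m : ℕ) : Decidable (IsClosedSet l m) :=
  inferInstanceAs (Decidable (∀ _ ∈ _, _))

/-- The diagram is connected. -/
def ConnectedList (n : ℕ) (l : List (ℕ × ℕ × ℕ)) : Prop :=
  ∀ m ∈ List.range (2 ^ n), IsClosedSet l m → m = 0 ∨ m = 2 ^ n - 1

instance (n : ℕ) (l : List (ℕ × ℕ × ℕ)) : Decidable (ConnectedList n l) :=
  inferInstanceAs (Decidable (∀ _ ∈ _, _))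

/-- The set of indices, encoded in binary, satisfies the parity condition for the arrows. -/
def IsEvenSet (l : List (ℕ × ℕ × ℕ)) (m : ℕ) : Prop :=
  ∀ a ∈ l, m.testBit a.2.2 = (m.testBit a.1 ^^ m.testBit a.2.1)

instance (l : List (ℕ × ℕ × ℕ)) (m : ℕ) : Decidable (IsEvenSet l m) :=
  inferInstanceAs (Decidable (∀ _ ∈ _, _))

/-- The sets of indices in the list are exactly those that satisfy the parity condition for the
arrows. -/
def SignatureList (n : ℕ) (l : List (ℕ × ℕ × ℕ)) (sig : List (List ℕ)) : Prop :=
  (∀ s ∈ sig, ∀ a ∈ l, (a.2.2 + 1 ∈ s ↔ (a.1 + 1 ∈ s ↔ a.2.1 + 1 ∉ s))) ∧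
  ∀ m ∈ List.range (2 ^ n), IsEvenSet l m →
    ∃ s ∈ sig, ∀ i ∈ List.range n, m.testBit i = decide (i + 1 ∈ s)

instance (n : ℕ) (l : List (ℕ × ℕ × ℕ)) (sig : List (List ℕ)) :
    Decidable (SignatureList n l sig) :=
  inferInstanceAs (Decidable (_ ∧ _))

/-- The pairing of the incidence vector of an arrow with an integer vector. -/
def pairing (p : ℕ → ℤ) (a : ℕ × ℕ × ℕ) : ℤ := p a.1 + p a.2.1 - p a.2.2

namespace Certificate

/-- The value of `lam` at an arrow. -/
def lamAt (ct : Certificate) (l : List (ℕ × ℕ × ℕ)) (a : ℕ × ℕ × ℕ) : ℚ :=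
  ct.lam.getD (l.idxOf a) 0

/-- The dual vector of an arrow. -/
def dualAt (ct : Certificate) (l : List (ℕ × ℕ × ℕ)) (a : ℕ × ℕ × ℕ) (h : ℕ) : ℤ :=
  (ct.dual.getD (l.idxOf a) []).getD h 0

end Certificate

/-- The diagonal derivation and the values `lam` are as required for the Nikolayevsky derivation. -/
def NikolayevskyList (r : Row) (l : List (ℕ × ℕ × ℕ)) (ct : Certificate) : Prop :=
  (∀ a ∈ l, pairing (r.weights.getD · 0) a = 0) ∧
  (0 < r.n ∧ r.scale * r.weights.getD 0 0 ≠ 0) ∧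
  (∀ a ∈ l, 0 < ct.lamAt l a) ∧
  ∀ h ∈ List.range r.n,
    (l.map fun a => ct.lamAt l a * pairing (fun i => if i = h then 1 else 0) a).sum = 1 - r.scale * r.weights.getD h 0

instance (r : Row) (l : List (ℕ × ℕ × ℕ)) (ct : Certificate) :
    Decidable (NikolayevskyList r l ct) :=
  inferInstanceAs (Decidable (_ ∧ _))

/-- The vectors are dual to the incidence vectors of the arrows. -/
def DualList (l : List (ℕ × ℕ × ℕ)) (P : ℕ × ℕ × ℕ → ℕ → ℤ) : Prop :=
  ∀ a ∈ l, ∀ a' ∈ l, pairing (P a) a' = if a = a' then 1 else 0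

instance (l : List (ℕ × ℕ × ℕ)) (P : ℕ × ℕ × ℕ → ℕ → ℤ) : Decidable (DualList l P) :=
  inferInstanceAs (Decidable (∀ _ ∈ _, _))

/-- The structure constants of the rows `r` and `r'` differ exactly in the sign of that of `a₀`. -/
def IsPartner (r r' : Row) (l : List (ℕ × ℕ × ℕ)) (a₀ : ℕ × ℕ × ℕ) : Prop :=
  r'.n = r.n ∧
  (∀ a ∈ l, r'.const a.1 a.2.1 a.2.2
    = if a = a₀ then -r.const a.1 a.2.1 a.2.2 else r.const a.1 a.2.1 a.2.2) ∧
  IsSupport r.n r'.const l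

instance (r r' : Row) (l : List (ℕ × ℕ × ℕ)) (a₀ : ℕ × ℕ × ℕ) : Decidable (IsPartner r r' l a₀) :=
  inferInstanceAs (Decidable (_ ∧ _))

/-- The conditions on the excess of a certificate. -/
def ExcessList (r : Row) (l : List (ℕ × ℕ × ℕ)) (ct : Certificate) : Excess → Prop
  | .none => DualList l (ct.dualAt l)
  | .half a₀ p d₀ =>
    a₀ ∈ l ∧ DualList (l.filter (· ≠ a₀)) (ct.dualAt l) ∧ d₀ ≠ 0 ∧
    (∀ a ∈ l.filter (· ≠ a₀), pairing (p.getD · 0) a = 0) ∧ pairing (p.getD · 0) a₀ = d₀ ∧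
    ∃ r' ∈ table, IsPartner r r' l a₀
  | .jacobi x y z w w' u =>
    mkArrow x y w ∈ l ∧ DualList (l.filter (· ≠ mkArrow x y w)) (ct.dualAt l) ∧
    (mkArrow w z u ∈ l ∧ mkArrow y z w' ∈ l ∧ mkArrow w' x u ∈ l) ∧
    [mkArrow x y w, mkArrow w z u, mkArrow y z w', mkArrow w' x u].Nodup ∧
    ct.lamAt l (mkArrow x y w) * ct.lamAt l (mkArrow w z u)
      = ct.lamAt l (mkArrow y z w') * ct.lamAt l (mkArrow w' x u) ∧
    r.const x y w * r.const w z u + r.const y z w' * r.const w' x u = 0 ∧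
    ∀ p ∈ List.range r.n, ¬ (mkArrow z x p ∈ l ∧ mkArrow p y u ∈ l)

instance (r : Row) (l : List (ℕ × ℕ × ℕ)) (ct : Certificate) :
    DecidablePred (ExcessList r l ct)
  | .none => inferInstanceAs (Decidable (DualList _ _))
  | .half _ _ _ => inferInstanceAs (Decidable (_ ∧ _))
  | .jacobi _ _ _ _ _ _ => inferInstanceAs (Decidable (_ ∧ _))

/-- The certificate is valid for the row. -/
structure IsValid (r : Row) (ct : Certificate) : Prop where
  nodup : r.arrowList.Nodup
  isSupport : IsSupport r.n r.const r.arrowList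
  isNiceList : IsNiceList r.n r.arrowList
  jacobi : JacobiList r.n r.const r.arrowList
  connected : ConnectedList r.n r.arrowList
  signature : SignatureList r.n r.arrowList r.sig
  nikolayevsky : NikolayevskyList r r.arrowList ct
  excess : ExcessList r r.arrowList ct ct.excess

lemma isValid_iff (r : Row) (ct : Certificate) : IsValid r ct ↔
    r.arrowList.Nodup ∧ IsSupport r.n r.const r.arrowList ∧ IsNiceList r.n r.arrowList ∧
    JacobiList r.n r.const r.arrowList ∧ ConnectedList r.n r.arrowList ∧
    SignatureList r.n r.arrowList r.sig ∧ NikolayevskyList r r.arrowList ct ∧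
    ExcessList r r.arrowList ct ct.excess :=
  ⟨fun h => ⟨h.1, h.2, h.3, h.4, h.5, h.6, h.7, h.8⟩,
    fun h => ⟨h.1, h.2.1, h.2.2.1, h.2.2.2.1, h.2.2.2.2.1, h.2.2.2.2.2.1, h.2.2.2.2.2.2.1,
      h.2.2.2.2.2.2.2⟩⟩

instance (r : Row) (ct : Certificate) : Decidable (IsValid r ct) :=
  decidable_of_iff' _ (isValid_iff r ct)

/-- Every row has a valid certificate. -/
theorem table_certified : List.Forall₂ IsValid table certificates := by
  decide +kernel

/-! ### Existence of a Lie algebra with given structure constants -/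

section Existence

/-- The underlying space of a Lie algebra given by structure constants. -/
def StructureSpace (n : ℕ) : Type := Fin n → ℝ

noncomputable instance (n : ℕ) : AddCommGroup (StructureSpace n) :=
  inferInstanceAs (AddCommGroup (Fin n → ℝ))

noncomputable instance (n : ℕ) : Module ℝ (StructureSpace n) :=
  inferInstanceAs (Module ℝ (Fin n → ℝ))

variable {n : ℕ}

/-- The bracket with structure constants `c`. -/
noncomputable def structureBracket (c : Fin n → Fin n → Fin n → ℝ) (x y : StructureSpace n) :
    StructureSpace n :=
  fun u => ∑ i, ∑ j, x i * y j * c i j u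

variable {c : Fin n → Fin n → Fin n → ℝ}

lemma structureBracket_skew (hs : ∀ i j k, c j i k = -c i j k) (x y : StructureSpace n)
    (u : Fin n) : structureBracket c x y u = -structureBracket c y x u := by
  simp only [structureBracket]
  rw [Finset.sum_comm, ← Finset.sum_neg_distrib]
  refine Finset.sum_congr rfl fun i _ => ?_
  rw [← Finset.sum_neg_distrib]
  refine Finset.sum_congr rfl fun j _ => ?_
  rw [hs i j u]
  ring

lemma structureBracket_structureBracket (x y z : StructureSpace n) (u : Fin n) :
    structureBracket c x (structureBracket c y z) u
      = ∑ i, ∑ j, ∑ k, x i * y j * z k * ∑ w, c j k w * c i w u := by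
  simp only [structureBracket, Finset.mul_sum, Finset.sum_mul]
  refine Finset.sum_congr rfl fun i _ => ?_
  rw [Finset.sum_comm]
  refine Finset.sum_congr rfl fun j _ => ?_
  rw [Finset.sum_comm]
  exact Finset.sum_congr rfl fun k _ => Finset.sum_congr rfl fun w _ => by ring

lemma structureBracket_leibniz (hs : ∀ i j k, c j i k = -c i j k)
    (hJ : ∀ i j k u, ∑ w, (c i j w * c w k u + c j k w * c w i u + c k i w * c w j u) = 0)
    (x y z : StructureSpace n) (u : Fin n) :
    structureBracket c x (structureBracket c y z) u
      = structureBracket c (structureBracket c x y) z u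
        + structureBracket c y (structureBracket c x z) u := by
  rw [structureBracket_skew hs (structureBracket c x y) z, structureBracket_structureBracket,
    structureBracket_structureBracket, structureBracket_structureBracket,
    Finset.sum_comm (γ := Fin n)
      (s := Finset.univ) (t := Finset.univ) (f := fun k i => ∑ j, z k * x i * y j * _),
    Finset.sum_comm (γ := Fin n) (s := Finset.univ) (t := Finset.univ)
      (f := fun j i => ∑ k, y j * x i * z k * _), neg_add_eq_sub, ← Finset.sum_sub_distrib]
  refine Finset.sum_congr rfl fun i _ => ?_
  rw [Finset.sum_comm (f := fun k j => z k * x i * y j * _), ← Finset.sum_sub_distrib]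
  refine Finset.sum_congr rfl fun j _ => ?_
  rw [← Finset.sum_sub_distrib]
  refine Finset.sum_congr rfl fun k _ => ?_
  have h := hJ i j k u
  have e : ∀ p q r : Fin n, ∑ w, c p q w * c w r u = -∑ w, c p q w * c r w u := by
    intro p q r
    rw [← Finset.sum_neg_distrib]
    exact Finset.sum_congr rfl fun w _ => by rw [hs r w u]; ring
  have e' : ∑ w, c k i w * c j w u = -∑ w, c i k w * c j w u := by
    rw [← Finset.sum_neg_distrib]
    exact Finset.sum_congr rfl fun w _ => by rw [hs i k w]; ring
  rw [Finset.sum_add_distrib, Finset.sum_add_distrib, e, e, e, e'] at h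
  linear_combination (-(x i * y j * z k)) * h

theorem exists_lieAlgebra_of_sc (hs : ∀ i j k, c j i k = -c i j k)
    (hJ : ∀ i j k u, ∑ w, (c i j w * c w k u + c j k w * c w i u + c k i w * c w j u) = 0) :
    ∃ (L : Type) (_ : LieRing L) (_ : LieAlgebra ℝ L) (b : Basis (Fin n) ℝ L),
      ∀ i j k, sc b i j k = c i j k := by
  let ring : LieRing (StructureSpace n) :=
    { (inferInstance : AddCommGroup (StructureSpace n)) with
      bracket := structureBracket c
      add_lie := fun x y z => by
        funext u
        change ∑ i, ∑ j, (x i + y i) * z j * c i j u = ∑ i, ∑ j, _ + ∑ i, ∑ j, _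
        simp only [add_mul, Finset.sum_add_distrib]
      lie_add := fun x y z => by
        funext u
        change ∑ i, ∑ j, x i * (y j + z j) * c i j u = ∑ i, ∑ j, _ + ∑ i, ∑ j, _
        simp only [mul_add, add_mul, Finset.sum_add_distrib]
      lie_self := fun x => by
        funext u
        have := structureBracket_skew hs x x u
        change structureBracket c x x u = 0
        linarith
      leibniz_lie := fun x y z => funext fun u => structureBracket_leibniz hs hJ x y z u }
  let alg : LieAlgebra ℝ (StructureSpace n) :=
    { (inferInstance : Module ℝ (StructureSpace n)) with
      lie_smul := fun t x y => by
        funext u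
        change ∑ i, ∑ j, x i * (t * y j) * c i j u = t * structureBracket c x y u
        simp only [structureBracket, Finset.mul_sum]
        exact Finset.sum_congr rfl fun i _ => Finset.sum_congr rfl fun j _ => by ring }
  let b : Basis (Fin n) ℝ (StructureSpace n) := Pi.basisFun ℝ (Fin n)
  have hb : ∀ i, b i = (Pi.single i (1 : ℝ) : Fin n → ℝ) := fun i => Pi.basisFun_apply ℝ (Fin n) i
  have hr : ∀ x k, b.repr x k = x k := fun x k => Pi.basisFun_repr ℝ (Fin n) x k
  refine ⟨StructureSpace n, ring, alg, b, fun i j k => ?_⟩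
  rw [sc, hr, hb, hb]
  change structureBracket c (Pi.single i (1 : ℝ) : Fin n → ℝ)
    (Pi.single j (1 : ℝ) : Fin n → ℝ) k = _
  simp only [structureBracket]
  rw [Finset.sum_eq_single i, Finset.sum_eq_single j]
  · simp
  · intro j' _ hj'
    simp [Pi.single_eq_of_ne hj']
  · simp
  · intro i' _ hi'
    simp [Pi.single_eq_of_ne hi']
  · simp

end Existence

/-! ### Lists of arrows -/

section Lists

variable {n : ℕ}

/-- Forgetting the bound on the indices of an arrow. -/
def toNat (a : Fin n × Fin n × Fin n) : ℕ × ℕ × ℕ := (a.1, a.2.1, a.2.2)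

lemma toNat_injective : Function.Injective (toNat (n := n)) := by
  rintro ⟨i, j, k⟩ ⟨i', j', k'⟩ h
  simp only [toNat, Prod.mk.injEq, Fin.val_inj] at h
  simp [h]

lemma toNat_mkArrow (i j k : Fin n) : toNat (mkArrow i j k) = mkArrow (i : ℕ) j k := by
  simp only [mkArrow, Fin.val_fin_lt]
  split_ifs <;> rfl

/-- The arrows in a list, as a finite set. -/
def arrowsOf (n : ℕ) (l : List (ℕ × ℕ × ℕ)) : Finset (Fin n × Fin n × Fin n) :=
  Finset.univ.filter fun a => toNat a ∈ l

lemma mem_arrowsOf {l : List (ℕ × ℕ × ℕ)} {a : Fin n × Fin n × Fin n} :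
    a ∈ arrowsOf n l ↔ toNat a ∈ l := by simp [arrowsOf]

variable {l : List (ℕ × ℕ × ℕ)}

lemma IsNiceList.exists_toNat (hl : IsNiceList n l) {a : ℕ × ℕ × ℕ} (ha : a ∈ l) :
    ∃ a' : Fin n × Fin n × Fin n, toNat a' = a := by
  obtain ⟨⟨h1, h2, h3⟩, -⟩ := hl a ha
  exact ⟨(⟨a.1, by omega⟩, ⟨a.2.1, by omega⟩, ⟨a.2.2, h3⟩), rfl⟩

lemma sum_arrowsOf (hl : IsNiceList n l) (hd : l.Nodup) (F : ℕ × ℕ × ℕ → ℝ) :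
    ∑ a ∈ arrowsOf n l, F (toNat a) = (l.map F).sum := by
  rw [← List.sum_toFinset F hd, ← Finset.sum_image (f := F) (g := toNat) (s := arrowsOf n l)
    fun _ _ _ _ h => toNat_injective h]
  refine Finset.sum_congr ?_ fun _ _ => rfl
  ext a
  simp only [Finset.mem_image, mem_arrowsOf, List.mem_toFinset]
  constructor
  · rintro ⟨a', h, rfl⟩
    exact h
  · intro ha
    obtain ⟨a', rfl⟩ := hl.exists_toNat ha
    exact ⟨a', ha, rfl⟩

lemma insert_arrowsOf_filter {a₀ : Fin n × Fin n × Fin n} (ha₀ : toNat a₀ ∈ l) :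
    insert a₀ (arrowsOf n (l.filter (· ≠ toNat a₀))) = arrowsOf n l := by
  ext a
  simp only [Finset.mem_insert, mem_arrowsOf, List.mem_filter, decide_eq_true_eq]
  constructor
  · rintro (rfl | h)
    exacts [ha₀, h.1]
  · intro h
    by_cases he : a = a₀
    · exact Or.inl he
    · exact Or.inr ⟨h, fun h' => he (toNat_injective h')⟩

lemma not_mem_arrowsOf_filter (a₀ : Fin n × Fin n × Fin n) :
    a₀ ∉ arrowsOf n (l.filter (· ≠ toNat a₀)) := by
  simp [mem_arrowsOf]

lemma DualList.isDual {P : ℕ × ℕ × ℕ → ℕ → ℤ} (h : DualList l P) :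
    IsDual (arrowsOf n l) (fun a h => P (toNat a) h) 1 where
  ne_zero := one_ne_zero
  pairing a ha a' ha' := by
    have := h _ (mem_arrowsOf.1 ha) _ (mem_arrowsOf.1 ha')
    simp only [toNat_injective.eq_iff] at this
    exact this

/-- The structure constants are nonzero exactly for the arrows in the list. -/
def HasSupport (c : Fin n → Fin n → Fin n → ℝ) (l : List (ℕ × ℕ × ℕ)) : Prop :=
  ∀ i j k, i < j → (c i j k ≠ 0 ↔ toNat (i, j, k) ∈ l)

variable {c : Fin n → Fin n → Fin n → ℝ}

lemma HasSupport.ne_zero_iff (hc : HasSupport c l) (hs : ∀ i j k, c j i k = -c i j k)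
    (hl : IsNiceList n l) (i j k : Fin n) : c i j k ≠ 0 ↔ toNat (mkArrow i j k) ∈ l := by
  rw [mkArrow]
  split_ifs with hij
  · exact hc i j k hij
  · rcases (not_lt.1 hij).lt_or_eq with h | h
    · rw [← hc j i k h, hs i j k, neg_ne_zero]
    · subst h
      constructor
      · intro h0
        exact absurd (by linarith [hs j j k]) h0
      · intro h0
        exact absurd (hl _ h0).1.1 (lt_irrefl _)

lemma HasSupport.arrows_eq (hc : HasSupport c l) (hl : IsNiceList n l) :
    arrows c = arrowsOf n l := by
  ext a
  rw [mem_arrows, mem_arrowsOf]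
  constructor
  · rintro ⟨h1, h2⟩
    exact (hc _ _ _ h1).1 h2
  · intro h
    have h1 : a.1 < a.2.1 := (hl _ h).1.1
    exact ⟨h1, (hc _ _ _ h1).2 h⟩

lemma HasSupport.niceTriangular (hc : HasSupport c l) (hs : ∀ i j k, c j i k = -c i j k)
    (hl : IsNiceList n l) : NiceTriangular c where
  tgt_unique i j k k' h h' := by
    rw [hc.ne_zero_iff hs hl] at h h'
    have := (hl _ h).2 _ h' (by
      rw [mkArrow, mkArrow]
      split_ifs <;> exact Or.inl ⟨rfl, rfl⟩)
    have := toNat_injective this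
    simp only [mkArrow] at this
    split_ifs at this <;> simpa using this
  src_unique i j j' k h h' := by
    rw [hc.ne_zero_iff hs hl] at h h'
    have := (hl _ h).2 _ h' (by
      rw [mkArrow, mkArrow]
      split_ifs <;> simp [toNat])
    have := toNat_injective this
    simp only [mkArrow] at this
    split_ifs at this <;> simp only [Prod.mk.injEq] at this
    · exact this.2.1
    · exact this.2.1.trans this.1
    · exact this.1.trans this.2.1
    · exact this.1
  lt_tgt i j k h := by
    rw [hc.ne_zero_iff hs hl] at h
    have := (hl _ h).1
    rw [toNat_mkArrow, mkArrow] at this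
    split_ifs at this
    · exact ⟨this.1.trans this.2.1, this.2.1⟩
    · exact ⟨this.2.1, this.1.trans this.2.1⟩

end Lists

/-! ### Consequences of a valid certificate -/

section Rows

variable {r : Row} {ct : Certificate}

lemma Row.structConst_eq (r : Row) (i j k : Fin r.n) : r.structConst i j k = r.const i j k := by
  rw [Row.structConst, Row.const]
  congr 4
  rw [List.getD_eq_getElem _ _ k.2]
  rfl

lemma Row.const_skew (r : Row) (i j k : ℕ) : r.const j i k = -r.const i j k := by
  simp only [Row.const]
  generalize r.d.getD k [] = l
  induction l with
  | nil => simp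
  | cons t l ih =>
    simp only [List.map_cons, List.sum_cons]
    linear_combination ih

lemma IsValid.hasSupport (h : IsValid r ct) :
    HasSupport (fun i j k : Fin r.n => (r.const i j k : ℝ)) r.arrowList := by
  intro i j k hij
  rw [Int.cast_ne_zero]
  constructor
  · intro h0
    exact ((h.isSupport.2 k (List.mem_range.2 k.2) j (List.mem_range.2 j.2) i
      (List.mem_range.2 hij))).resolve_left h0
  · intro hm
    rcases h.isSupport.1 _ hm with h1 | h1 <;>
      simp only [toNat] at h1 <;> simp [h1]

end Rows

section Rows

variable {r : Row} {ct : Certificate}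

lemma IsValid.jacobiator_eq_zero (h : IsValid r ct) (i j k u : Fin r.n) :
    jacobiator r.n r.const i j k u = 0 := by
  have hsup := h.hasSupport
  have hsk : ∀ i j k : Fin r.n, (r.const j i k : ℝ) = -r.const i j k := fun i j k => by
    exact_mod_cast r.const_skew i j k
  have ne : ∀ i j k : Fin r.n, r.const i j k ≠ 0 → toNat (mkArrow i j k) ∈ r.arrowList :=
    fun i j k h0 => (hsup.ne_zero_iff hsk h.isNiceList i j k).1 (Int.cast_ne_zero.2 h0)
  have cyc : ∀ i j k : ℕ, jacobiator r.n r.const i j k u = jacobiator r.n r.const j k i u :=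
    fun i j k => Finset.sum_congr rfl fun w _ => by ring
  have swap : ∀ i j k : ℕ, jacobiator r.n r.const i j k u = -jacobiator r.n r.const j i k u := by
    intro i j k
    simp only [jacobiator]
    rw [← Finset.sum_neg_distrib]
    refine Finset.sum_congr rfl fun w _ => ?_
    rw [r.const_skew i j w, r.const_skew j k w, r.const_skew k i w]
    ring
  have key : ∀ i j k w : Fin r.n, r.const i j w * r.const w k u ≠ 0 →
      jacobiator r.n r.const i j k u = 0 := by
    intro i j k w hne
    have h1 := ne _ _ _ (left_ne_zero_of_mul hne)
    have h2 := ne _ _ _ (right_ne_zero_of_mul hne)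
    have h3 := h.jacobi _ h1 _ h2
    simp only [mkArrow] at h3
    split_ifs at h3
    · exact h3.1 rfl
    · rw [swap]
      exact neg_eq_zero.2 (h3.1 rfl)
    · exact h3.2 rfl
    · rw [swap]
      exact neg_eq_zero.2 (h3.2 rfl)
  by_contra hne
  obtain ⟨w, hw, hne'⟩ := Finset.exists_ne_zero_of_sum_ne_zero hne
  lift w to Fin r.n using Finset.mem_range.1 hw
  by_cases h1 : r.const i j w * r.const w k u = 0
  · by_cases h2 : r.const j k w * r.const w i u = 0
    · have h3 : r.const k i w * r.const w j u ≠ 0 := by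
        intro h3
        exact hne' (by rw [h1, h2, h3]; rfl)
      exact hne (by rw [cyc, cyc]; exact key k i j w h3)
    · exact hne (by rw [cyc]; exact key j k i w h2)
  · exact hne (key i j k w h1)

variable {L : Type*} [LieRing L] [LieAlgebra ℝ L]

lemma hasStructure_iff (b : Basis (Fin r.n) ℝ L) :
    HasStructure r b ↔ ∀ i j k, sc b i j k = r.const i j k := by
  constructor
  · intro h i j k
    rw [sc, h i j]
    simp [Finsupp.single_apply, Row.structConst_eq]
  · intro h i j
    rw [lie_basis]
    exact Finset.sum_congr rfl fun k _ => by rw [h, Row.structConst_eq]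

theorem IsValid.exists_lieAlgebra (h : IsValid r ct) :
    ∃ (L : Type) (_ : LieRing L) (_ : LieAlgebra ℝ L) (b : Basis (Fin r.n) ℝ L),
      HasStructure r b := by
  obtain ⟨L, _, _, b, hb⟩ := exists_lieAlgebra_of_sc
    (c := fun i j k : Fin r.n => (r.const i j k : ℝ))
    (fun i j k => by exact_mod_cast r.const_skew i j k)
    (fun i j k u => by
      have := h.jacobiator_eq_zero i j k u
      rw [jacobiator, Finset.sum_range] at this
      exact_mod_cast this)
  exact ⟨L, _, _, b, (hasStructure_iff b).2 hb⟩

/-- The Jacobi square given by natural numbers. -/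
lemma exists_jacobiSquare (h : IsValid r ct) {x y z w w' u : ℕ}
    (h₀ : mkArrow x y w ∈ r.arrowList) (h₁ : mkArrow w z u ∈ r.arrowList)
    (h₂ : mkArrow y z w' ∈ r.arrowList) :
    ∃ q : JacobiSquare r.n, (q.x : ℕ) = x ∧ (q.y : ℕ) = y ∧ (q.z : ℕ) = z ∧ (q.w : ℕ) = w ∧
      (q.w' : ℕ) = w' ∧ (q.u : ℕ) = u := by
  have bound : ∀ {i j k : ℕ}, mkArrow i j k ∈ r.arrowList → i < r.n ∧ j < r.n ∧ k < r.n := by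
    intro i j k hm
    obtain ⟨⟨b1, b2, b3⟩, -⟩ := h.isNiceList _ hm
    rw [mkArrow] at b1 b2 b3
    split_ifs at b1 b2 b3 <;> simp only at b1 b2 b3 <;> omega
  exact ⟨⟨⟨x, (bound h₀).1⟩, ⟨y, (bound h₀).2.1⟩, ⟨z, (bound h₁).2.1⟩, ⟨w, (bound h₀).2.2⟩,
    ⟨w', (bound h₂).2.2⟩, ⟨u, (bound h₁).2.2⟩⟩, rfl, rfl, rfl, rfl, rfl, rfl⟩

/-- What the excess of a valid certificate amounts to. -/
inductive ExcessSpec (r : Row) (lam : Fin r.n × Fin r.n × Fin r.n → ℝ) : Prop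
  | none (P) (hP : IsDual (arrowsOf r.n r.arrowList) P 1)
  | half (S a₀ P P' d) (hS : insert a₀ S = arrowsOf r.n r.arrowList) (ha₀ : a₀ ∉ S)
    (hP : IsDual S P 1) (hP' : IsDual (insert a₀ S) P' d)
    (partner : ∃ r' ∈ table, IsPartner r r' r.arrowList (toNat a₀))
  | jacobi (S) (q : JacobiSquare r.n) (P) (hS : insert q.a₀ S = arrowsOf r.n r.arrowList)
    (hq : q.Within S) (hP : IsDual S P 1)
    (hlam : lam q.a₀ * lam q.a₁ = lam q.a₂ * lam q.a₃)
    (hconst : r.const q.x q.y q.w * r.const q.w q.z q.u +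
      r.const q.y q.z q.w' * r.const q.w' q.x q.u = 0)
    (hzero : ∀ p, ¬ (mkArrow q.z q.x p ∈ arrowsOf r.n r.arrowList ∧
      mkArrow p q.y q.u ∈ arrowsOf r.n r.arrowList))

lemma IsValid.excessSpec (h : IsValid r ct) :
    ExcessSpec r (fun a => (ct.lamAt r.arrowList (toNat a) : ℝ)) := by
  have he := h.excess
  cases hx : ct.excess with
  | none =>
    rw [hx] at he
    exact .none _ (DualList.isDual he)
  | half a₀ p d₀ =>
    rw [hx] at he
    obtain ⟨h1, h2, h3, h4, h5, h6⟩ := he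
    obtain ⟨a₀, rfl⟩ := h.isNiceList.exists_toNat h1
    refine .half _ a₀ _ _ _ (insert_arrowsOf_filter h1) (not_mem_arrowsOf_filter a₀) h2.isDual
      (IsDual.insert_of_orthogonal (p := fun i => p.getD i 0) (not_mem_arrowsOf_filter a₀) h2.isDual
        h3 (fun a ha => h4 _ (mem_arrowsOf.1 ha)) h5) h6
  | jacobi x y z w w' u =>
    rw [hx] at he
    obtain ⟨h0, h1, ⟨m1, m2, m3⟩, h3, h4, h5, h6⟩ := he
    obtain ⟨q, rfl, rfl, rfl, rfl, rfl, rfl⟩ := exists_jacobiSquare h h0 m1 m2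
    simp only [← toNat_mkArrow] at h0 h1 m1 m2 m3 h3 h4 h6
    have hn := h3
    simp only [List.nodup_cons, List.mem_cons, List.not_mem_nil, or_false, not_or,
      toNat_injective.eq_iff] at hn
    refine .jacobi _ q _ (insert_arrowsOf_filter h0) ⟨not_mem_arrowsOf_filter _, ?_, ?_, ?_,
      hn.2.1.1, hn.2.1.2, hn.2.2.1⟩ h1.isDual ?_ h5 ?_
    · exact mem_arrowsOf.2 (List.mem_filter.2 ⟨m1,
        decide_eq_true fun e => hn.1.1 (toNat_injective e).symm⟩)
    · exact mem_arrowsOf.2 (List.mem_filter.2 ⟨m2,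
        decide_eq_true fun e => hn.1.2.1 (toNat_injective e).symm⟩)
    · exact mem_arrowsOf.2 (List.mem_filter.2 ⟨m3,
        decide_eq_true fun e => hn.1.2.2 (toNat_injective e).symm⟩)
    · exact_mod_cast h4
    · intro p hp
      refine h6 p (List.mem_range.2 p.2) ?_
      rw [← toNat_mkArrow, ← toNat_mkArrow]
      exact ⟨mem_arrowsOf.1 hp.1, mem_arrowsOf.1 hp.2⟩

lemma IsValid.isRigid (h : IsValid r ct) :
    IsRigid (arrowsOf r.n r.arrowList) (fun a => (ct.lamAt r.arrowList (toNat a) : ℝ)) := by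
  have hpos : ∀ a ∈ arrowsOf r.n r.arrowList, (0 : ℝ) < ct.lamAt r.arrowList (toNat a) :=
    fun a ha => by exact_mod_cast h.nikolayevsky.2.2.1 _ (mem_arrowsOf.1 ha)
  rcases h.excessSpec with ⟨P, hP⟩ | ⟨S, a₀, P, P', d, hS, ha₀, hP, hP', -⟩ |
    ⟨S, q, P, hS, hq, hP, hlam, -, -⟩
  · exact hP.isRigid hpos
  · rw [← hS] at hpos ⊢
    exact hP'.isRigid hpos
  · rw [← hS] at hpos ⊢
    exact q.isRigid hq hP hpos hlam

lemma exists_testBit {n : ℕ} (p : Fin n → Prop) :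
    ∃ m ∈ List.range (2 ^ n), ∀ i : Fin n, m.testBit i = true ↔ p i := by
  classical
  refine ⟨Nat.ofBits fun i => decide (p i), List.mem_range.2 (Nat.ofBits_lt_two_pow _), fun i => ?_⟩
  rw [Nat.testBit_ofBits_lt _ _ i.2]
  simp

section Structure

variable {b : Basis (Fin r.n) ℝ L}

lemma IsValid.hasSupport_sc (h : IsValid r ct) (hb : HasStructure r b) :
    HasSupport (sc b) r.arrowList := by
  rw [hasStructure_iff] at hb
  have : sc b = fun i j k : Fin r.n => (r.const i j k : ℝ) := by
    funext i j k
    exact hb i j k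
  rw [this]
  exact h.hasSupport

lemma IsValid.niceTriangular (h : IsValid r ct) (hb : HasStructure r b) :
    NiceTriangular (sc b) :=
  (h.hasSupport_sc hb).niceTriangular (sc_skew b) h.isNiceList

lemma IsValid.isIrreducible (h : IsValid r ct) (hb : HasStructure r b) : IsIrreducible b := by
  rw [isIrreducible_iff]
  intro s hs hne
  obtain ⟨m, hm, hbit⟩ := exists_testBit (fun i => i ∈ s)
  have hclosed : IsClosedSet r.arrowList m := by
    intro a ha
    obtain ⟨a, rfl⟩ := h.isNiceList.exists_toNat ha
    have hlt : a.1 < a.2.1 := (h.isNiceList _ ha).1.1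
    have h0 := ((h.hasSupport_sc hb) _ _ _ hlt).2 ha
    have h1 := hs _ _ _ h0
    have h2 := hs a.2.1 a.1 a.2.2 (by rw [sc_skew]; exact neg_ne_zero.2 h0)
    simp only [toNat, Bool.eq_iff_iff, hbit]
    exact ⟨h1, h2⟩
  rcases h.connected m hm hclosed with rfl | rfl
  · obtain ⟨x, hx⟩ := hne
    have := (hbit x).2 hx
    simp at this
  · ext x
    have := (hbit x).1 (by simp [Nat.testBit_two_pow_sub_one])
    simpa using this

lemma IsValid.sum_lam (h : IsValid r ct) (k : Fin r.n) :
    ∑ a ∈ arrowsOf r.n r.arrowList, (ct.lamAt r.arrowList (toNat a) : ℝ) * root a k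
      = 1 - r.nik k := by
  have h1 := h.nikolayevsky.2.2.2 k (List.mem_range.2 k.2)
  have h2 := sum_arrowsOf h.isNiceList h.nodup (fun a => ((ct.lamAt r.arrowList a *
    pairing (fun i => if i = (k : ℕ) then 1 else 0) a : ℚ) : ℝ))
  have h3 : ∀ a : Fin r.n × Fin r.n × Fin r.n, root a k =
      ((pairing (fun i => if i = (k : ℕ) then 1 else 0) (toNat a) : ℤ) : ℝ) := by
    intro a
    simp only [root, pairing, toNat, Fin.val_inj]
    push_cast
    rfl
  rw [Row.nik]
  have h4 : (1 : ℝ) - ((r.scale * r.weights.getD k 0 : ℚ) : ℝ)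
      = ((1 - r.scale * r.weights.getD k 0 : ℚ) : ℝ) := by push_cast; rfl
  have h5 : ∀ l : List ℚ, ((l.sum : ℚ) : ℝ) = (l.map fun x : ℚ => (x : ℝ)).sum :=
    fun l => map_list_sum (Rat.castHom ℝ) l
  rw [h4, ← h1, h5, List.map_map]
  simp only [h3]
  refine Eq.trans (Finset.sum_congr rfl fun a _ => ?_) h2
  push_cast
  rfl

lemma IsValid.isDiagonalNikolayevsky (h : IsValid r ct) (hb : HasStructure r b) :
    IsDiagonalNikolayevsky b r.nik := by
  have hsup := h.hasSupport_sc hb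
  refine isDiagonalNikolayevsky_of_sum (h.niceTriangular hb) ?_
    (fun a => (ct.lamAt r.arrowList (toNat a) : ℝ)) ?_
  · have : ∀ i j k, toNat (i, j, k) ∈ r.arrowList → r.nik i + r.nik j = r.nik k := by
      intro i j k hm
      have := h.nikolayevsky.1 _ hm
      simp only [pairing, toNat] at this
      simp only [Row.nik]
      have h' : (r.weights.getD i 0 : ℝ) + r.weights.getD j 0 - r.weights.getD k 0 = 0 := by
        exact_mod_cast this
      push_cast
      linear_combination (r.scale : ℝ) * h'
    intro i j k hc
    rw [hsup.ne_zero_iff (sc_skew b) h.isNiceList, mkArrow] at hc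
    split_ifs at hc
    · exact this _ _ _ hc
    · rw [add_comm]
      exact this _ _ _ hc
  · intro k
    rw [hsup.arrows_eq h.isNiceList]
    exact h.sum_lam k

lemma IsValid.signatures_eq (h : IsValid r ct) (hb : HasStructure r b) :
    signatures b = r.sigSet := by
  have hsup := h.hasSupport_sc hb
  have hv : r.nik ≠ 0 := by
    intro h0
    have := congrFun h0 ⟨0, h.nikolayevsky.2.1.1⟩
    simp only [Row.nik, Pi.zero_apply, Rat.cast_eq_zero] at this
    exact h.nikolayevsky.2.1.2 this
  have hpos : ∀ a ∈ arrowsOf r.n r.arrowList, (0 : ℝ) < ct.lamAt r.arrowList (toNat a) :=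
    fun a ha => by exact_mod_cast h.nikolayevsky.2.2.1 _ (mem_arrowsOf.1 ha)
  have hA := hsup.arrows_eq h.isNiceList
  rw [signatures_eq_of_isRigid (h.niceTriangular hb) ?_ hv (h.isDiagonalNikolayevsky hb)
    (hA ▸ hpos) (fun k => by rw [hA]; exact h.sum_lam k) (hA ▸ h.isRigid), hA]
  · ext s
    simp only [Set.mem_ofPred_eq, Row.sigSet]
    constructor
    · intro hs
      obtain ⟨m, hm, hbit⟩ := exists_testBit (fun i => i ∈ s)
      have heven : IsEvenSet r.arrowList m := by
        intro a ha
        obtain ⟨a, rfl⟩ := h.isNiceList.exists_toNat ha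
        have := hs a (mem_arrowsOf.2 ha)
        rw [← hbit, ← hbit, ← hbit] at this
        simp only [toNat]
        revert this
        cases m.testBit a.1 <;> cases m.testBit a.2.1 <;> cases m.testBit a.2.2 <;> simp
      obtain ⟨t, ht, hi⟩ := h.signature.2 m hm heven
      refine ⟨t, ht, fun i => ?_⟩
      rw [← hbit, hi i (List.mem_range.2 i.2), decide_eq_true_eq]
    · rintro ⟨t, ht, hi⟩ a ha
      rw [hi, hi, hi]
      exact h.signature.1 t ht _ (mem_arrowsOf.1 ha)
  · intro i j k hc
    rw [hasStructure_iff] at hb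
    rw [hsup.ne_zero_iff (sc_skew b) h.isNiceList] at hc
    have := h.isSupport.1 _ hc
    rw [hb]
    rw [mkArrow] at this
    split_ifs at this <;> simp only [toNat] at this
    · rcases this with h1 | h1 <;> simp [h1]
    · rw [r.const_skew j i k]
      rcases this with h1 | h1 <;> simp [h1]

end Structure

end Rows

/-! ### Normalization of the structure constants -/

section Normalization

variable {r : Row} {ct : Certificate} {L : Type*} [LieRing L] [LieAlgebra ℝ L]

lemma unitsSMul_reindex_apply {m n : ℕ} (b : Basis (Fin n) ℝ L) (e : Fin m ≃ Fin n)
    (c : Fin m → ℝˣ) (i : Fin m) :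
    (b.reindex e.symm).unitsSMul c i = (c i : ℝ) • b (e i) := by
  rw [Basis.unitsSMul_apply, Basis.reindex_apply, Equiv.symm_symm, Units.smul_def]

lemma isEquivalentTo_of_scale {n : ℕ} {l : List (ℕ × ℕ × ℕ)} {b : Basis (Fin n) ℝ L}
    (hsup : HasSupport (sc b) l) (hn : r.n = n) (hr : IsSupport n r.const l) {t : Fin n → ℝ}
    (ht : ∀ i, t i ≠ 0) (h : ∀ a : Fin n × Fin n × Fin n, a ∈ arrowsOf n l →
      t a.1 * t a.2.1 / t a.2.2 * sc b a.1 a.2.1 a.2.2 = r.const a.1 a.2.1 a.2.2) :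
    IsEquivalentTo b r (finCongr hn) := by
  have key : ∀ i j k : Fin n, i < j → t i * t j / t k * sc b i j k = r.const i j k := by
    intro i j k hij
    by_cases hm : toNat (i, j, k) ∈ l
    · exact h (i, j, k) (mem_arrowsOf.2 hm)
    · have h1 : sc b i j k = 0 := by
        by_contra h0
        exact hm ((hsup i j k hij).1 h0)
      have h2 : r.const i j k = 0 := (hr.2 k (List.mem_range.2 k.2) j (List.mem_range.2 j.2) i
        (List.mem_range.2 hij)).resolve_right hm
      rw [h1, h2, mul_zero, Int.cast_zero]
  have key' : ∀ i j k : Fin n, t i * t j / t k * sc b i j k = r.const i j k := by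
    intro i j k
    rcases lt_trichotomy i j with hij | rfl | hij
    · exact key i j k hij
    · have : r.const i i k = 0 := by linarith [r.const_skew i i k]
      rw [sc_self, this, mul_zero, Int.cast_zero]
    · rw [sc_skew b j i k, r.const_skew j i k, Int.cast_neg, ← key j i k hij]
      ring
  refine ⟨fun i => Units.mk0 (t (finCongr hn i)) (ht _), ?_⟩
  rw [hasStructure_iff]
  intro i j k
  rw [sc_of_rescale (c := fun i => t (finCongr hn i)) (fun i => ht _)
    (unitsSMul_reindex_apply b (finCongr hn) _)]
  exact key' _ _ _

/-- The monomial identity between the structure constants that follows from a Jacobi identity with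
two nonzero terms. -/
lemma sc_jacobiSquare {n : ℕ} {b : Basis (Fin n) ℝ L} (hb : NiceTriangular (sc b))
    (q : JacobiSquare n) (h₀ : sc b q.x q.y q.w ≠ 0) (h₂ : sc b q.y q.z q.w' ≠ 0)
    (hz : ∀ p, sc b q.z q.x p * sc b p q.y q.u = 0) :
    sc b q.x q.y q.w * sc b q.w q.z q.u + sc b q.y q.z q.w' * sc b q.w' q.x q.u = 0 := by
  have h := sc_jacobi b q.x q.y q.z q.u
  simp only [Finset.sum_add_distrib, hz, add_zero] at h
  rwa [Finset.sum_eq_single q.w, Finset.sum_eq_single q.w'] at h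
  · intro p _ hp
    by_contra hne
    exact hp (hb.tgt_unique _ _ _ _ (left_ne_zero_of_mul hne) h₂)
  · simp
  · intro p _ hp
    by_contra hne
    exact hp (hb.tgt_unique _ _ _ _ (left_ne_zero_of_mul hne) h₀)
  · simp

theorem IsValid.exists_isEquivalentTo (hr : r ∈ table) (h : IsValid r ct)
    {b : Basis (Fin r.n) ℝ L} (hsup : HasSupport (sc b) r.arrowList) :
    ∃ r' ∈ table, ∃ e : Fin r'.n ≃ Fin r.n, IsEquivalentTo b r' e := by
  have hb : NiceTriangular (sc b) := hsup.niceTriangular (sc_skew b) h.isNiceList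
  set y : Fin r.n × Fin r.n × Fin r.n → ℝ :=
    fun a => r.const a.1 a.2.1 a.2.2 / sc b a.1 a.2.1 a.2.2 with hy
  have hA := hsup.arrows_eq h.isNiceList
  have hsc : ∀ a ∈ arrowsOf r.n r.arrowList, sc b a.1 a.2.1 a.2.2 ≠ 0 := fun a ha =>
    (mem_arrows.1 (hA ▸ ha)).2
  have hc1 : ∀ a ∈ arrowsOf r.n r.arrowList, (r.const a.1 a.2.1 a.2.2 : ℝ) ≠ 0 := by
    intro a ha
    rcases h.isSupport.1 _ (mem_arrowsOf.1 ha) with h1 | h1 <;>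
      simp only [toNat] at h1 <;> simp [h1]
  have hy0 : ∀ a ∈ arrowsOf r.n r.arrowList, y a ≠ 0 := fun a ha =>
    div_ne_zero (hc1 a ha) (hsc a ha)
  have hyc : ∀ a ∈ arrowsOf r.n r.arrowList,
      y a * sc b a.1 a.2.1 a.2.2 = r.const a.1 a.2.1 a.2.2 := fun a ha =>
    div_mul_cancel₀ _ (hsc a ha)
  rcases h.excessSpec with ⟨P, hP⟩ | ⟨S, a₀, P, P', d, hS, ha₀, hP, hP', r', hr', hpart⟩ |
    ⟨S, q, P, hS, hq, hP, -, hconst, hzero⟩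
  · obtain ⟨t, ht, h1⟩ := hP.exists_ne_zero y hy0
    exact ⟨r, hr, _, isEquivalentTo_of_scale hsup rfl h.isSupport ht fun a ha => by
      rw [h1 a ha, hyc a ha]⟩
  · obtain ⟨t, ht, h1, h2⟩ := hP.exists_up_to_sign ha₀ hP' y (hS ▸ hy0)
    have ha₀m : a₀ ∈ arrowsOf r.n r.arrowList := hS ▸ Finset.mem_insert_self _ _
    have hSm : ∀ a ∈ S, a ∈ arrowsOf r.n r.arrowList := fun a ha =>
      hS ▸ Finset.mem_insert_of_mem ha
    rcases h2 with h2 | h2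
    · refine ⟨r, hr, _, isEquivalentTo_of_scale hsup rfl h.isSupport ht fun a ha => ?_⟩
      rw [← hS] at ha
      rcases Finset.mem_insert.1 ha with rfl | ha
      · rw [h2, hyc _ ha₀m]
      · rw [h1 a ha, hyc a (hSm a ha)]
    · refine ⟨r', hr', _, isEquivalentTo_of_scale hsup hpart.1 hpart.2.2 ht fun a ha => ?_⟩
      have hval := hpart.2.1 _ (mem_arrowsOf.1 ha)
      simp only [toNat_injective.eq_iff] at hval
      simp only [toNat] at hval
      rw [hval]
      rw [← hS] at ha
      rcases Finset.mem_insert.1 ha with rfl | ha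
      · rw [if_pos rfl, h2, neg_mul, hyc _ ha₀m, Int.cast_neg]
      · rw [if_neg (fun e : a = a₀ => ha₀ (e ▸ ha)), h1 a ha, hyc a (hSm a ha)]
  · have hSm : ∀ a ∈ S, a ∈ arrowsOf r.n r.arrowList := fun a ha =>
      hS ▸ Finset.mem_insert_of_mem ha
    have ne : ∀ i j k, mkArrow i j k ∈ arrowsOf r.n r.arrowList ↔ sc b i j k ≠ 0 := fun i j k => by
      rw [hsup.ne_zero_iff (sc_skew b) h.isNiceList, mem_arrowsOf]
    have hym : ∀ i j k, y (mkArrow i j k) = r.const i j k / sc b i j k := by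
      intro i j k
      rw [mkArrow]
      split_ifs
      · rfl
      · simp only [hy]
        rw [sc_skew b i j k, r.const_skew i j k, Int.cast_neg, neg_div_neg_eq]
    have h0 : sc b q.x q.y q.w ≠ 0 := (ne _ _ _).1 (hS ▸ Finset.mem_insert_self _ _)
    have h1 : sc b q.w q.z q.u ≠ 0 := (ne _ _ _).1 (hSm _ hq.mem₁)
    have h2 : sc b q.y q.z q.w' ≠ 0 := (ne _ _ _).1 (hSm _ hq.mem₂)
    have h3 : sc b q.w' q.x q.u ≠ 0 := (ne _ _ _).1 (hSm _ hq.mem₃)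
    have hyq : y q.a₀ * y q.a₁ = y q.a₂ * y q.a₃ := by
      have e1 := sc_jacobiSquare hb q h0 h2 (fun p => by
        by_contra hne
        exact hzero p ⟨(ne _ _ _).2 (left_ne_zero_of_mul hne),
          (ne _ _ _).2 (right_ne_zero_of_mul hne)⟩)
      have e2 : (r.const q.x q.y q.w : ℝ) * r.const q.w q.z q.u +
          r.const q.y q.z q.w' * r.const q.w' q.x q.u = 0 := by exact_mod_cast hconst
      simp only [JacobiSquare.a₀, JacobiSquare.a₁, JacobiSquare.a₂, JacobiSquare.a₃, hym]
      field_simp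
      linear_combination (sc b q.y q.z q.w' * sc b q.w' q.x q.u) * e2 -
        (r.const q.y q.z q.w' * r.const q.w' q.x q.u : ℝ) * e1
    obtain ⟨t, ht, h4⟩ := hP.exists_ne_zero y fun a ha => hy0 a (hSm a ha)
    have h5 := q.solves_first hq ht (fun a ha => hy0 a (hSm a ha)) hyq h4
    refine ⟨r, hr, _, isEquivalentTo_of_scale hsup rfl h.isSupport ht fun a ha => ?_⟩
    have ha' := ha
    rw [← hS] at ha'
    rcases Finset.mem_insert.1 ha' with rfl | ha'
    · rw [h5, hyc _ ha]
    · rw [h4 a ha', hyc a ha]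

end Normalization

/-! ### Enumeration of the nice diagrams -/

/-- The pairs `(i, j)` with `i < j < n`. -/
def sourcePairs (n : ℕ) : List (ℕ × ℕ) :=
  (List.range n).flatMap fun j => (List.range j).map fun i => (i, j)

/-- The arrow `{i, j} → k` shares no source with an arrow of the list that has the same target. -/
def IsAdmissible (l : List (ℕ × ℕ × ℕ)) (p : ℕ × ℕ) (k : ℕ) : Prop :=
  ∀ a ∈ l, a.2.2 = k → a.1 ≠ p.1 ∧ a.1 ≠ p.2 ∧ a.2.1 ≠ p.1 ∧ a.2.1 ≠ p.2

instance (l : List (ℕ × ℕ × ℕ)) (p : ℕ × ℕ) (k : ℕ) : Decidable (IsAdmissible l p k) :=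
  inferInstanceAs (Decidable (∀ _ ∈ _, _))

/-- The diagrams with `n` nodes whose arrows start from the given pairs. -/
def diagrams (n : ℕ) : List (ℕ × ℕ) → List (List (ℕ × ℕ × ℕ))
  | [] => [[]]
  | p :: ps => (diagrams n ps).flatMap fun l =>
      l :: ((List.range n).filter fun k => p.2 < k ∧ IsAdmissible l p k).map
        fun k => (p.1, p.2, k) :: l

/-- There is a component of a Jacobi identity of which exactly one term is nonzero. -/
def JacobiObstruction (n : ℕ) (l : List (ℕ × ℕ × ℕ)) : Prop :=
  ∃ a ∈ l, ∃ a' ∈ l, ∃ z ∈ [a'.1, a'.2.1], a' = mkArrow a.2.2 z a'.2.2 ∧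
    ∀ w ∈ List.range n, ¬(mkArrow a.2.1 z w ∈ l ∧ mkArrow w a.1 a'.2.2 ∈ l) ∧
      ¬(mkArrow z a.1 w ∈ l ∧ mkArrow w a.2.1 a'.2.2 ∈ l)

set_option synthInstance.maxHeartbeats 200000 in
set_option synthInstance.maxSize 1024 in
instance (n : ℕ) (l : List (ℕ × ℕ × ℕ)) : Decidable (JacobiObstruction n l) :=
  inferInstanceAs (Decidable (∃ _ ∈ _, _))

/-- The arrow obtained by relabelling the nodes. -/
def renameArrow (p : List ℕ) (a : ℕ × ℕ × ℕ) : ℕ × ℕ × ℕ :=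
  mkArrow (p.getD a.1 0) (p.getD a.2.1 0) (p.getD a.2.2 0)

/-- The list `p` gives an isomorphism from the diagram `l` to the diagram `l'`. -/
def IsRenaming (n : ℕ) (p : List ℕ) (l l' : List (ℕ × ℕ × ℕ)) : Prop :=
  (∀ a ∈ l, renameArrow p a ∈ l') ∧ (∀ a' ∈ l', a' ∈ l.map (renameArrow p)) ∧
    (∀ i ∈ List.range n, p.getD i 0 < n) ∧ ∀ i ∈ List.range n, ∃ j ∈ List.range n, p.getD j 0 = i

instance (n : ℕ) (p : List ℕ) (l l' : List (ℕ × ℕ × ℕ)) : Decidable (IsRenaming n p l l') :=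
  inferInstanceAs (Decidable (_ ∧ _))

/-- Permutations that suffice to bring every diagram into the form used in the table. -/
def renamings : List (List ℕ) :=
  [[1, 0, 2, 3, 4, 5], [0, 1, 2, 3, 4, 5], [2, 1, 0, 3, 4, 5], [2, 0, 1, 3, 4, 5],
   [1, 2, 0, 3, 4, 5], [0, 2, 1, 3, 4, 5], [1, 0, 3, 2, 4, 5], [0, 1, 3, 2, 4, 5],
   [1, 0, 2, 4, 3, 5], [0, 1, 2, 4, 3, 5], [2, 1, 0, 4, 3, 5], [2, 0, 1, 4, 3, 5],
   [1, 2, 0, 4, 3, 5], [0, 2, 1, 4, 3, 5], [0, 1, 2, 3, 5, 4], [1, 0, 2, 3, 5, 4],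
   [1, 2, 0, 3, 5, 4], [2, 1, 0, 3, 5, 4], [2, 0, 1, 3, 5, 4], [0, 2, 1, 3, 5, 4],
   [2, 0, 4, 1, 3, 5], [1, 0, 3, 2, 5, 4], [0, 2, 4, 1, 3, 5], [0, 1, 3, 2, 5, 4],
   [1, 2, 3, 0, 4, 5], [0, 2, 3, 1, 4, 5], [2, 3, 1, 0, 4, 5], [2, 1, 3, 0, 4, 5],
   [2, 0, 3, 1, 4, 5], [2, 3, 0, 1, 4, 5], [1, 0, 3, 5, 2, 4], [1, 0, 4, 2, 3, 5],
   [0, 1, 3, 5, 2, 4], [1, 0, 3, 4, 2, 5], [0, 1, 4, 2, 3, 5], [0, 1, 3, 4, 2, 5],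
   [2, 3, 1, 0, 5, 4], [2, 1, 3, 0, 5, 4], [2, 3, 0, 1, 5, 4], [0, 3, 2, 1, 5, 4],
   [2, 0, 3, 1, 5, 4], [0, 2, 3, 1, 5, 4]]

/-- An isomorphism invariant of diagrams: a list of the degrees of the nodes, up to ordering. -/
def degreeCode (n : ℕ) (l : List (ℕ × ℕ × ℕ)) : ℕ :=
  ((List.range n).map fun i =>
    10 ^ (l.map fun a => if a.2.2 = i then 5 else if a.1 = i ∨ a.2.1 = i then 1 else 0).sum).sum

/-- The connected component of the node `0`, encoded in binary. -/
def component (n : ℕ) (l : List (ℕ × ℕ × ℕ)) : ℕ :=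
  (List.range n).foldl (fun m _ => l.foldl (fun m a =>
    if m.testBit a.1 || m.testBit a.2.1 || m.testBit a.2.2 then
      m ||| 2 ^ a.1 ||| 2 ^ a.2.1 ||| 2 ^ a.2.2 else m) m) 1

/-- The node `0` is not connected with some other node. -/
def IsDisconnected (n : ℕ) (l : List (ℕ × ℕ × ℕ)) : Prop :=
  (∃ j ∈ List.range n, (component n l).testBit j = false) ∧ (component n l).testBit 0 = true ∧
    IsClosedSet l (component n l)

instance (n : ℕ) (l : List (ℕ × ℕ × ℕ)) : Decidable (IsDisconnected n l) :=
  inferInstanceAs (Decidable (_ ∧ _))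

/-- The diagram violates the Jacobi identity, or it is not connected, or it is isomorphic to the
diagram of a row of the table. -/
def IsClassified (n : ℕ) (l : List (ℕ × ℕ × ℕ)) : Prop :=
  IsDisconnected n l ∨ JacobiObstruction n l ∨
    ∃ r ∈ table, (r.n = n ∧ degreeCode n l = degreeCode n r.arrowList) ∧
      ∃ p ∈ renamings, IsRenaming n p l r.arrowList

instance (n : ℕ) (l : List (ℕ × ℕ × ℕ)) : Decidable (IsClassified n l) :=
  inferInstanceAs (Decidable (_ ∨ _))

theorem diagrams_classified : ∀ n ∈ [2, 3, 4, 5, 6], ∀ l ∈ diagrams n (sourcePairs n),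
    IsNiceList n l ∧ IsClassified n l := by
  decide +kernel

/-! ### The classification -/

section Classification

variable {n : ℕ} {l : List (ℕ × ℕ × ℕ)}

lemma mem_sourcePairs {p : ℕ × ℕ} : p ∈ sourcePairs n ↔ p.1 < p.2 ∧ p.2 < n := by
  simp only [sourcePairs, List.mem_flatMap, List.mem_range, List.mem_map]
  constructor
  · rintro ⟨j, hj, i, hi, rfl⟩
    exact ⟨hi, hj⟩
  · rintro ⟨h1, h2⟩
    exact ⟨p.2, h2, p.1, h1, rfl⟩

lemma nodup_sourcePairs (n : ℕ) : (sourcePairs n).Nodup := by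
  refine List.nodup_flatMap.2 ⟨fun j _ => List.nodup_range.map fun i i' h => (Prod.ext_iff.1 h).1,
    List.nodup_range.imp fun {j j'} hne => ?_⟩
  simp only [Function.onFun, List.disjoint_left, List.mem_map]
  rintro _ ⟨i, -, rfl⟩ ⟨i', -, h⟩
  exact hne (Prod.ext_iff.1 h).2.symm

lemma exists_mem_diagrams {c : Fin n → Fin n → Fin n → ℝ} (hc : NiceTriangular c)
    (hs : ∀ i j k, c j i k = -c i j k) (ps : List (ℕ × ℕ)) (hnd : ps.Nodup)
    (hlt : ∀ p ∈ ps, p.1 < p.2) :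
    ∃ l ∈ diagrams n ps, ∀ i j k : ℕ, (i, j, k) ∈ l ↔
      (i, j) ∈ ps ∧ ∃ i' j' k' : Fin n, toNat (i', j', k') = (i, j, k) ∧ c i' j' k' ≠ 0 := by
  induction ps with
  | nil => exact ⟨[], by simp [diagrams], by simp⟩
  | cons p ps ih =>
    obtain ⟨hp, hnd⟩ := List.nodup_cons.1 hnd
    obtain ⟨l, hl, h⟩ := ih hnd fun q hq => hlt q (List.mem_cons_of_mem _ hq)
    by_cases hex : ∃ i' j' k' : Fin n, ((i' : ℕ), (j' : ℕ)) = p ∧ c i' j' k' ≠ 0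
    · obtain ⟨x, y, z, rfl, hne⟩ := hex
      have hxy := hlt _ List.mem_cons_self
      refine ⟨((x : ℕ), (y : ℕ), (z : ℕ)) :: l, ?_, ?_⟩
      · simp only [diagrams, List.mem_flatMap]
        refine ⟨l, hl, List.mem_cons_of_mem _ (List.mem_map.2 ⟨z, ?_, rfl⟩)⟩
        refine List.mem_filter.2 ⟨List.mem_range.2 z.2,
          decide_eq_true ⟨(hc.lt_tgt _ _ _ hne).2, ?_⟩⟩
        rintro ⟨i, j, k⟩ ha hk
        obtain ⟨hmem, i', j', k', he, hne'⟩ := (h i j k).1 ha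
        have hij := hlt _ (List.mem_cons_of_mem _ hmem)
        simp only [toNat, Prod.mk.injEq] at he
        obtain ⟨rfl, rfl, rfl⟩ := he
        obtain rfl := Fin.ext hk
        have hne₂ : c y x k' ≠ 0 := by rwa [hs x y, neg_ne_zero]
        have hne₂' : c j' i' k' ≠ 0 := by rwa [hs i' j', neg_ne_zero]
        refine ⟨fun e => ?_, fun e => ?_, fun e => ?_, fun e => ?_⟩ <;>
          obtain rfl := Fin.ext e
        · obtain rfl := hc.src_unique _ _ _ _ hne' hne
          exact hp hmem
        · obtain rfl := hc.src_unique _ _ _ _ hne' hne₂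
          exact absurd hxy hij.asymm
        · obtain rfl := hc.src_unique _ _ _ _ hne₂' hne
          exact absurd hxy hij.asymm
        · obtain rfl := hc.src_unique _ _ _ _ hne₂' hne₂
          exact hp hmem
      · intro i j k
        rw [List.mem_cons, List.mem_cons, h]
        constructor
        · rintro (e | ⟨h1, h2⟩)
          · simp only [Prod.mk.injEq] at e
            exact ⟨Or.inl (by simp [e]), x, y, z, by simp [toNat, e], hne⟩
          · exact ⟨Or.inr h1, h2⟩
        · rintro ⟨h1 | h1, i', j', k', he, hne'⟩
          · left
            simp only [toNat, Prod.mk.injEq] at he h1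
            obtain rfl : i' = x := Fin.ext (he.1.trans h1.1)
            obtain rfl : j' = y := Fin.ext (he.2.1.trans h1.2)
            obtain rfl := hc.tgt_unique _ _ _ _ hne' hne
            simp [he]
          · exact Or.inr ⟨h1, i', j', k', he, hne'⟩
    · refine ⟨l, List.mem_flatMap.2 ⟨l, hl, List.mem_cons_self⟩, fun i j k => ?_⟩
      rw [h, List.mem_cons]
      constructor
      · exact fun ⟨h1, h2⟩ => ⟨Or.inr h1, h2⟩
      · rintro ⟨rfl | h1, i', j', k', he, hne'⟩
        · refine absurd ⟨i', j', k', ?_, hne'⟩ hex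
          simp only [toNat, Prod.mk.injEq] at he
          simp [he]
        · exact ⟨h1, i', j', k', he, hne'⟩

lemma exists_hasSupport {c : Fin n → Fin n → Fin n → ℝ} (hc : NiceTriangular c)
    (hs : ∀ i j k, c j i k = -c i j k) : ∃ l ∈ diagrams n (sourcePairs n), HasSupport c l := by
  obtain ⟨l, hl, h⟩ := exists_mem_diagrams hc hs _ (nodup_sourcePairs n)
    fun p hp => (mem_sourcePairs.1 hp).1
  refine ⟨l, hl, fun i j k hij => ?_⟩
  rw [toNat, h]
  constructor
  · exact fun hne => ⟨mem_sourcePairs.2 ⟨hij, j.2⟩, i, j, k, rfl, hne⟩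
  · rintro ⟨-, i', j', k', he, hne⟩
    have : (i', j', k') = (i, j, k) := toNat_injective he
    simp only [Prod.mk.injEq] at this
    obtain ⟨rfl, rfl, rfl⟩ := this
    exact hne

lemma mkArrow_comm {i j : ℕ} (h : i ≠ j) (k : ℕ) : mkArrow j i k = mkArrow i j k := by
  simp only [mkArrow]
  split_ifs <;> first | rfl | (exfalso; omega)

variable {L : Type*} [LieRing L] [LieAlgebra ℝ L] {b : Basis (Fin n) ℝ L}

lemma not_jacobiObstruction (hsup : HasSupport (sc b) l) (hl : IsNiceList n l) :
    ¬JacobiObstruction n l := by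
  rintro ⟨a, ha, a', ha', z, -, he, hw⟩
  have hb := hsup.niceTriangular (sc_skew b) hl
  have ne : ∀ i j k : Fin n, sc b i j k ≠ 0 ↔ mkArrow (i : ℕ) j k ∈ l := fun i j k => by
    rw [hsup.ne_zero_iff (sc_skew b) hl, toNat_mkArrow]
  obtain ⟨⟨x, y, w⟩, rfl⟩ := hl.exists_toNat ha
  obtain ⟨⟨p, q, u⟩, rfl⟩ := hl.exists_toNat ha'
  have hz : z < n := by
    rw [mkArrow] at he
    split_ifs at he <;> simp only [toNat, Prod.mk.injEq] at he
    · exact he.2.1 ▸ q.2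
    · exact he.1 ▸ p.2
  lift z to Fin n using hz
  rw [he] at ha'
  have hxy : x < y := (hl _ ha).1.1
  have h0 : sc b x y w ≠ 0 := (hsup x y w hxy).2 ha
  have h1 : sc b w z u ≠ 0 := (ne _ _ _).2 ha'
  have h2 : ∀ v, sc b y z v * sc b v x u = 0 := fun v => by
    by_contra hne
    exact (hw v (List.mem_range.2 v.2)).1
      ⟨(ne _ _ _).1 (left_ne_zero_of_mul hne), (ne _ _ _).1 (right_ne_zero_of_mul hne)⟩
  have h3 : ∀ v, sc b z x v * sc b v y u = 0 := fun v => by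
    by_contra hne
    exact (hw v (List.mem_range.2 v.2)).2
      ⟨(ne _ _ _).1 (left_ne_zero_of_mul hne), (ne _ _ _).1 (right_ne_zero_of_mul hne)⟩
  have h := sc_jacobi b x y z u
  simp only [h2, h3, add_zero] at h
  rw [Finset.sum_eq_single w] at h
  · exact mul_ne_zero h0 h1 h
  · intro v _ hv
    by_contra hne
    exact hv (hb.tgt_unique _ _ _ _ (left_ne_zero_of_mul hne) h0)
  · simp

lemma not_isDisconnected (hn : 0 < n) (hsup : HasSupport (sc b) l) (hl : IsNiceList n l)
    (hb : IsIrreducible b) : ¬IsDisconnected n l := by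
  rintro ⟨⟨j, hj, hj'⟩, h0, hcl⟩
  have h := isIrreducible_iff.1 hb {i | (component n l).testBit i = true} ?_ ⟨⟨0, hn⟩, h0⟩
  · have : (⟨j, List.mem_range.1 hj⟩ : Fin n) ∈
        ({i : Fin n | (component n l).testBit i = true} : Set (Fin n))ᶜ := by simp [hj']
    rw [h] at this
    exact this
  · intro i j k hne
    have := hcl _ ((hsup.ne_zero_iff (sc_skew b) hl i j k).1 hne)
    rw [toNat_mkArrow, mkArrow] at this
    simp only [Set.mem_ofPred_eq]
    split_ifs at this
    · rw [this.1]
    · rw [this.2]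

/-- An isomorphism of diagrams gives a relabelling of the basis. -/
lemma IsRenaming.exists_equiv {p : List ℕ} {l' : List (ℕ × ℕ × ℕ)}
    (h : IsRenaming n p l l') (hsup : HasSupport (sc b) l) (hl : IsNiceList n l) :
    ∃ e : Fin n ≃ Fin n, HasSupport (sc (b.reindex e)) l' := by
  obtain ⟨h1, h2, hlt, hsurj⟩ := h
  let f : Fin n → Fin n := fun i => ⟨p.getD i 0, hlt i (List.mem_range.2 i.2)⟩
  have hf : Function.Surjective f := fun i => by
    obtain ⟨j, hj, e⟩ := hsurj i (List.mem_range.2 i.2)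
    exact ⟨⟨j, List.mem_range.1 hj⟩, Fin.ext e⟩
  let e : Fin n ≃ Fin n := Equiv.ofBijective f (Finite.surjective_iff_bijective.1 hf)
  have hrel : ∀ i j k : Fin n, renameArrow p (toNat (i, j, k)) = mkArrow (e i : ℕ) (e j) (e k) :=
    fun _ _ _ => rfl
  refine ⟨e, fun i j k hij => ?_⟩
  obtain ⟨i, rfl⟩ := e.surjective i
  obtain ⟨j, rfl⟩ := e.surjective j
  obtain ⟨k, rfl⟩ := e.surjective k
  have hv : (e i : ℕ) ≠ e j := fun h => hij.ne (Fin.ext h)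
  rw [sc_ne_zero_of_rescale (c := fun _ => 1) (e := e.symm) (b := b) (fun _ => one_ne_zero)
    (fun i => by rw [Basis.reindex_apply, one_smul]), e.symm_apply_apply, e.symm_apply_apply,
    e.symm_apply_apply]
  have htgt : toNat (e i, e j, e k) = mkArrow (e i : ℕ) (e j) (e k) := by
    rw [mkArrow, if_pos (Fin.lt_def.1 hij)]
    rfl
  rw [htgt]
  constructor
  · intro h0
    rw [hsup.ne_zero_iff (sc_skew b) hl] at h0
    have := h1 _ h0
    rw [mkArrow] at this
    split_ifs at this
    · rwa [hrel] at this
    · rwa [hrel, mkArrow_comm hv] at this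
  · intro h0
    obtain ⟨a, ha, he⟩ := List.mem_map.1 (h2 _ h0)
    obtain ⟨⟨x, y, z⟩, rfl⟩ := hl.exists_toNat ha
    have hxy : x < y := (hl _ ha).1.1
    have hne0 := (hsup x y z hxy).2 ha
    rw [hrel, ← htgt, mkArrow] at he
    split_ifs at he <;> simp only [toNat, Prod.mk.injEq, Fin.val_inj, e.injective.eq_iff] at he
    · obtain ⟨rfl, rfl, rfl⟩ := he
      exact hne0
    · obtain ⟨rfl, rfl, rfl⟩ := he
      rwa [sc_skew b x y, neg_ne_zero]

lemma IsEquivalentTo.of_reindex {m : ℕ} {b : Basis (Fin m) ℝ L} {r : Row} {e : Fin m ≃ Fin n}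
    {e' : Fin r.n ≃ Fin n} (h : IsEquivalentTo (b.reindex e) r e') :
    IsEquivalentTo b r (e'.trans e.symm) := by
  obtain ⟨c, hc⟩ := h
  refine ⟨c, ?_⟩
  convert hc using 1
  refine Basis.eq_of_apply_eq fun i => ?_
  rw [unitsSMul_reindex_apply, unitsSMul_reindex_apply, Basis.reindex_apply]
  rfl

lemma exists_isValid {r : Row} (hr : r ∈ table) : ∃ ct, IsValid r ct := by
  obtain ⟨i, hi, rfl⟩ := List.getElem_of_mem hr
  exact ⟨_, table_certified.get hi (table_certified.length_eq ▸ hi)⟩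

lemma exists_reindex_niceTriangular [LieRing.IsNilpotent L] (hb : IsNice b) :
    ∃ e : Fin n ≃ Fin n, NiceTriangular (sc (b.reindex e)) := by
  obtain ⟨ρ, hρ⟩ := exists_depth hb
  have hresc : ∀ i, b.reindex (Tuple.sort ρ).symm i = (1 : ℝ) • b (Tuple.sort ρ i) := fun i => by
    rw [Basis.reindex_apply, one_smul, Equiv.symm_symm]
  have hnice := isNice_iff.1
    ((isNice_of_rescale (c := fun _ => 1) (fun _ => one_ne_zero) hresc).2 hb)
  refine ⟨(Tuple.sort ρ).symm, hnice.1, hnice.2, fun i j k h => ?_⟩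
  rw [sc_ne_zero_of_rescale (c := fun _ => 1) (fun _ => one_ne_zero) hresc] at h
  exact ⟨(Tuple.monotone_sort ρ).reflect_lt (hρ _ _ _ h).1,
    (Tuple.monotone_sort ρ).reflect_lt (hρ _ _ _ h).2⟩

theorem exists_isEquivalentTo [LieRing.IsNilpotent L] (h2 : 2 ≤ n) (h6 : n ≤ 6) (hb : IsNice b)
    (hirr : IsIrreducible b) : ∃ r ∈ table, ∃ e : Fin r.n ≃ Fin n, IsEquivalentTo b r e := by
  obtain ⟨e₁, htri⟩ := exists_reindex_niceTriangular hb
  obtain ⟨l, hl, hsup⟩ := exists_hasSupport htri (sc_skew _)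
  obtain ⟨hnice, hclass⟩ := diagrams_classified n (by simp; omega) l hl
  have hirr' : IsIrreducible (b.reindex e₁) := (isIrreducible_of_rescale (c := fun _ => 1)
    (e := e₁.symm) (fun _ => one_ne_zero) fun i => by
      rw [Basis.reindex_apply, one_smul]).2 hirr
  rcases hclass with h | h | ⟨r, hr, ⟨rfl, -⟩, p, -, hp⟩
  · exact absurd h (not_isDisconnected (by omega) hsup hnice hirr')
  · exact absurd h (not_jacobiObstruction hsup hnice)
  · obtain ⟨e₂, hsup₂⟩ := hp.exists_equiv hsup hnice
    obtain ⟨ct, hct⟩ := exists_isValid hr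
    obtain ⟨r', hr', e₃, h₃⟩ := hct.exists_isEquivalentTo hr hsup₂
    exact ⟨r', hr', _, h₃.of_reindex.of_reindex⟩

end Classification

end NiceNilsoliton

open NiceNilsoliton Module in
theorem mainTheorem4 :
    -- every row of the table is a Lie algebra
    (∀ r ∈ table, ∃ (L : Type) (_ : LieRing L) (_ : LieAlgebra ℝ L) (b : Basis (Fin r.n) ℝ L),
      HasStructure r b) ∧
    -- every nice Lie algebra equivalent to a row is irreducible, nice and nilpotent, and has the
    -- listed Nikolayevsky derivation and set of signatures
    (∀ r ∈ table, ∀ (L : Type*) [LieRing L] [LieAlgebra ℝ L] (n : ℕ) (b : Basis (Fin n) ℝ L)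
      (e : Fin r.n ≃ Fin n), IsEquivalentTo b r e →
        IsNice b ∧ LieRing.IsNilpotent L ∧ IsIrreducible b ∧
        IsDiagonalNikolayevsky b (fun i => r.nik (e.symm i)) ∧
        signatures b = (fun s => s.map e.toEmbedding) '' r.sigSet) ∧
    -- every irreducible nice nilpotent Lie algebra of dimension 2, ..., 6 is in the table
    (∀ (L : Type*) [LieRing L] [LieAlgebra ℝ L] (n : ℕ) (b : Basis (Fin n) ℝ L),
      2 ≤ n → n ≤ 6 → IsNice b → LieRing.IsNilpotent L → IsIrreducible b →
        ∃ r ∈ table, ∃ e : Fin r.n ≃ Fin n, IsEquivalentTo b r e) := by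
  refine ⟨fun r hr => ?_, fun r hr L _ _ n b e h => ?_, fun L _ _ n b h2 h6 hb _ hirr =>
    exists_isEquivalentTo h2 h6 hb hirr⟩
  · obtain ⟨ct, hct⟩ := exists_isValid hr
    exact hct.exists_lieAlgebra
  · obtain ⟨ct, hct⟩ := exists_isValid hr
    obtain ⟨c, hc⟩ := h
    have hc0 : ∀ i, (c i : ℝ) ≠ 0 := fun i => (c i).ne_zero
    have hb' := unitsSMul_reindex_apply b e c
    have htri := hct.niceTriangular hc
    refine ⟨(isNice_of_rescale hc0 hb').1 htri.isNice, htri.isNilpotent,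
      (isIrreducible_of_rescale hc0 hb').1 (hct.isIrreducible hc),
      (isDiagonalNikolayevsky_of_rescale hb' _).1 (hct.isDiagonalNikolayevsky hc), ?_⟩
    rw [signatures_of_rescale hc0 hb', hct.signatures_eq hc]
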